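/- For each $n\in\mathbb N$ let $[n]=\{1,\dots,n\}=N_1(n)\cup N_2(n)$ be a partition into disjoint sets (for instance, into the first $|N_1(n)|$ indices and the remaining ones), with $N_1(n)\neq\emptyset$ for all sufficiently large $n$, and with asymptotic dimensions $$d_1=\lim_{n\to\infty}\frac{|N_1(n)|}{n}=0,\qquad d_2=\lim_{n\to\infty}\frac{|N_2(n)|}{n}=1 .$$ Let $V=(v_{p,q})_{p,q\in\{1,2\}}$ be a real symmetric matrix and, for each $n$, let $Y(n)=(Y_{i,j}(n))$ be a random $n\times n$ complex matrix on some probability space such that $Y(n)$ is almost surely Hermitian, the real random variables $\mathrm{Re}\,Y_{i,j}(n),\ \mathrm{Im}\,Y_{i,j}(n)$ $(1\le i\le j\le n)$ are independent centered Gaussian variables (point masses at $0$ allowed), and $$\mathbb E|Y_{i,j}(n)|^2=\frac{v_{p,q}}{n}\qquad\text{whenever } (i,j)\in N_p(n)\times N_q(n).$$ Let $\beta_1=v_{2,1}>0$, $\beta_2=v_{2,2}>0$ and $\alpha_1,\alpha_2\in\mathbb R$, and put $$M(n)=Y(n)+\alpha_1I_1(n)+\alpha_2I_2(n),$$ where $I_p(n)$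 is the diagonal matrix with diagonal entries $1$ at the indices in $N_p(n)$ and $0$ elsewhere. For a random $n\times n$ matrix $A$ let $\tau_1(n)(A)=\mathbb E\big(\frac1{|N_1(n)|}\sum_{i\in N_1(n)}A_{i,i}\big)$ be its partial trace. Let $\mathcal M$ be the complex Hilbert space with orthonormal basis $\Omega_1,\ \Omega_2,\ e_2^{\otimes k}\otimes e_1\ (k\ge 0),\ e_2^{\otimes l}\ (l\ge 1)$. Let $\wp_1,\wp_2$ be the bounded operators on $\mathcal M$ with $\wp_1\Omega_1=\sqrt{\beta_1}\,e_1$, $\wp_1=0$ on the other basis vectors, and $\wp_2\Omega_1=0$, $\wp_2\Omega_2=\sqrt{\beta_2}\,e_2$, $\wp_2(e_2^{\otimes k}\otimes e_1)=\sqrt{\beta_2}\,e_2^{\otimes(k+1)}\otimes e_1$ for $k\ge0$, $\wp_2(e_2^{\otimes l})=\sqrt{\beta_2}\,e_2^{\otimes(l+1)}$ for $l\ge1$. Put $$\omega=\wp_1+\wp_1^*+\wp_2+\wp_2^*,\qquad \gamma=(\alpha_2-\alpha_1)\big(\beta_1^{-1}\wp_1\wp_1^*+\beta_2^{-1}\wp_2\wp_2^*\big)+\alpha_1,\qquad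 \Psi_1(T)=\langle\Omega_1,T\,\Omega_1\rangle .$$ Then for every integer $m\ge 0$ the random variable $\frac1{|N_1(n)|}\sum_{i\in N_1(n)}(M(n)^m)_{i,i}$ is integrable (for every $n$ with $N_1(n)\ne\emptyset$), and $$\lim_{n\to\infty}\tau_1(n)\big(M(n)^m\big)=\Psi_1\big((\omega+\gamma)^m\big).$$ Moreover, there is exactly one free Meixner law $\mu$ corresponding to $(\alpha_1,\alpha_2,\beta_1,\beta_2)$, and $\Psi_1((\omega+\gamma)^m)=\int x^m\,d\mu(x)$ for every $m\ge0$. Here a probability measure $\mu$ on $\mathbb R$ with finite moments of all orders is called a free Meixner law corresponding to $(\alpha_1,\alpha_2,\beta_1,\beta_2)$ if its Jacobi sequences are $(a_1,a_2,a_3,\dots)=(\alpha_1,\alpha_2,\alpha_2,\dots)$ and $(b_1,b_2,b_3,\dots)=(\beta_1,\beta_2,\beta_2,\dots)$, that is, if the monic polynomials given by $P_0=1$, $P_1=x-a_1$, $P_{k+2}=(x-a_{k+2})P_{k+1}-b_{k+1}P_k$ $(k\ge0)$ satisfy $\int P_jP_k\,d\mu=0$ for $j\ne k$ and $\int P_k^2\,d\mu=b_1b_2\cdots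 b_k$ for all $k\ge0$. -/

import Mathlib

open MeasureTheory ProbabilityTheory Filter Topology
open scoped NNReal ENNReal

namespace FreeMeixner

noncomputable section

/-! Random matrices with a `2 × 2` block structure.

The blocks are labelled by `Fin 2`, so the labels `0, 1` stand for the usual labels `1, 2`. A partition
`[n] = N₁ ∪ N₂` into disjoint sets is given by the map `blk : Fin n → Fin 2` that sends every index to
the label of the set containing it. -/

/-- The set `N_p` of a partition. -/
def part {n : ℕ} (blk : Fin n → Fin 2) (p : Fin 2) : Finset (Fin n) :=
  Finset.univ.filter fun i => blk i = p

/-- The diagonal matrix `I_p`, the part of the unit matrix supported by `N_p`. -/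
def blockId {n : ℕ} (blk : Fin n → Fin 2) (p : Fin 2) : Matrix (Fin n) (Fin n) ℂ :=
  Matrix.diagonal fun i => if blk i = p then 1 else 0

/-- The normalized partial trace over the basis vectors indexed by `N_p`. -/
def partialTrace {n : ℕ} (blk : Fin n → Fin 2) (p : Fin 2) (A : Matrix (Fin n) (Fin n) ℂ) : ℂ :=
  ((part blk p).card : ℂ)⁻¹ * ∑ i ∈ part blk p, A i i

/-- The partial trace of a random matrix: the expectation of the normalized partial trace. -/
def expPartialTrace {Ω : Type*} [MeasurableSpace Ω] (P : Measure Ω) {n : ℕ} (blk : Fin n → Fin 2)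
    (p : Fin 2) (A : Ω → Matrix (Fin n) (Fin n) ℂ) : ℂ :=
  ∫ ω, partialTrace blk p (A ω) ∂P

/-- Hermitian Gaussian random `n × n` matrices with block-identical variances `V p q / n`: the real and
imaginary parts of the entries `Y i j`, `i ≤ j`, are independent centered Gaussian variables (point
masses at zero are allowed, as for the imaginary parts of the diagonal entries), and
`E |Y i j| ^ 2 = V p q / n` for `i ∈ N_p`, `j ∈ N_q`. -/
structure IsBlockGaussian {Ω : Type*} [MeasurableSpace Ω] (P : Measure Ω) {n : ℕ}
    (blk : Fin n → Fin 2) (V : Matrix (Fin 2) (Fin 2) ℝ)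
    (Y : Ω → Matrix (Fin n) (Fin n) ℂ) : Prop where
  hermitian : ∀ᵐ ω ∂P, (Y ω).IsHermitian
  gaussian_re : ∀ i j, i ≤ j → ∃ s : ℝ≥0, HasLaw (fun ω => (Y ω i j).re) (gaussianReal 0 s) P
  gaussian_im : ∀ i j, i ≤ j → ∃ s : ℝ≥0, HasLaw (fun ω => (Y ω i j).im) (gaussianReal 0 s) P
  indep : iIndepFun
    (Sum.elim
      (fun (q : {q : Fin n × Fin n // q.1 ≤ q.2}) (ω : Ω) => (Y ω q.1.1 q.1.2).re)
      (fun (q : {q : Fin n × Fin n // q.1 ≤ q.2}) (ω : Ω) => (Y ω q.1.1 q.1.2).im)) P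
  variance : ∀ i j, ∫ ω, ‖Y ω i j‖ ^ 2 ∂P = V (blk i) (blk j) / n

/-- The random matrix `M = Y + α₁ I₁ + α₂ I₂`. -/
def meixnerMatrix {Ω : Type*} {n : ℕ} (blk : Fin n → Fin 2) (α₁ α₂ : ℝ)
    (Y : Ω → Matrix (Fin n) (Fin n) ℂ) (ω : Ω) : Matrix (Fin n) (Fin n) ℂ :=
  Y ω + (α₁ : ℂ) • blockId blk 0 + (α₂ : ℂ) • blockId blk 1

/-! The matricially free Fock space of tracial type over two one-dimensional Hilbert spaces
`ℂ e₁` and `ℂ e₂`, realized as the Hilbert space with its canonical orthonormal basis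
`Ω₁, Ω₂, e₂^{⊗k} ⊗ e₁ (k ≥ 0), e₂^{⊗l} (l ≥ 1)`. -/

/-- The labels of the canonical basis: `word₁ k` is the label of `e₂^{⊗k} ⊗ e₁`, and `word₂ k` is the
label of `e₂^{⊗(k+1)}`. -/
inductive FockIndex : Type
  | vac₁ : FockIndex
  | vac₂ : FockIndex
  | word₁ (k : ℕ) : FockIndex
  | word₂ (k : ℕ) : FockIndex
  deriving DecidableEq

/-- The Fock space. -/
abbrev Fock : Type := lp (fun _ : FockIndex => ℂ) 2

/-- The canonical basis vectors. -/
def vec (i : FockIndex) : Fock := lp.single 2 i (1 : ℂ)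

theorem sum_elim_le {ι : Type*} (pre : ι → Option ι)
    (hpre : ∀ i j k, pre i = some k → pre j = some k → i = j)
    {g : ι → ℝ} (hg : ∀ i, 0 ≤ g i) (hs : Summable g) (s : Finset ι) :
    ∑ i ∈ s, (pre i).elim 0 g ≤ ∑' i, g i := by
  classical
  have h1 : ∑ i ∈ s, (pre i).elim 0 g
      = ∑ i ∈ s.filter (fun i => (pre i).isSome), (pre i).elim 0 g := by
    refine (Finset.sum_filter_of_ne ?_).symm
    intro i _ hi
    cases h : pre i with
    | none => simp [h] at hi
    | some k => simp
  have h2 : ∑ i ∈ s.filter (fun i => (pre i).isSome), (pre i).elim 0 g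
      = ∑ j ∈ (s.filter (fun i => (pre i).isSome)).image (fun i => (pre i).getD i), g j := by
    rw [Finset.sum_image]
    · refine Finset.sum_congr rfl ?_
      intro i hi
      obtain ⟨k, hk⟩ := Option.isSome_iff_exists.1 (Finset.mem_filter.1 hi).2
      simp [hk]
    · intro i hi j hj hij
      obtain ⟨k, hk⟩ := Option.isSome_iff_exists.1 (Finset.mem_filter.1 hi).2
      obtain ⟨l, hl⟩ := Option.isSome_iff_exists.1 (Finset.mem_filter.1 hj).2
      simp only [hk, hl, Option.getD_some] at hij
      exact hpre i j k hk (hij ▸ hl)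
  rw [h1, h2]
  exact hs.sum_le_tsum _ fun i _ => hg i

theorem sum_norm_elim_le {ι : Type*} (pre : ι → Option ι)
    (hpre : ∀ i j k, pre i = some k → pre j = some k → i = j)
    (x : lp (fun _ : ι => ℂ) 2) (s : Finset ι) :
    ∑ i ∈ s, ‖(pre i).elim 0 (fun j => x j)‖ ^ (2 : ℝ≥0∞).toReal ≤ ‖x‖ ^ (2 : ℝ≥0∞).toReal := by
  have h0 : 0 < (2 : ℝ≥0∞).toReal := by norm_num
  rw [lp.norm_rpow_eq_tsum h0 x]
  refine le_trans (le_of_eq ?_) (sum_elim_le pre hpre (fun i => by positivity)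
    ((lp.memℓp x).summable h0) s)
  refine Finset.sum_congr rfl fun i _ => ?_
  cases pre i <;> simp

/-- The operator on `ℓ²` that sends the basis vector `k` to the basis vector `i` if `pre i = some k`,
and to zero if there is no such `i`. -/
def shiftOp {ι : Type*} (pre : ι → Option ι)
    (hpre : ∀ i j k, pre i = some k → pre j = some k → i = j) :
    lp (fun _ : ι => ℂ) 2 →L[ℂ] lp (fun _ : ι => ℂ) 2 :=
  LinearMap.mkContinuous
    { toFun := fun x => ⟨fun i => (pre i).elim 0 (fun j => x j),
        memℓp_gen' (C := ‖x‖ ^ (2 : ℝ≥0∞).toReal) (sum_norm_elim_le pre hpre x)⟩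
      map_add' := fun x y => by
        ext i
        simp only [lp.coeFn_add, Pi.add_apply]
        cases pre i <;> simp
      map_smul' := fun c x => by
        ext i
        simp only [lp.coeFn_smul, Pi.smul_apply, RingHom.id_apply]
        cases pre i <;> simp }
    1 (fun x => by
      rw [one_mul]
      exact lp.norm_le_of_forall_sum_le (by norm_num) (norm_nonneg x)
        (sum_norm_elim_le pre hpre x))

/-- The label of the basis vector that `℘₁` maps to a multiple of the given one. -/
def pre₁ : FockIndex → Option FockIndex
  | .word₁ 0 => some .vac₁
  | _ => none

/-- The label of the basis vector that `℘₂` maps to a multiple of the given one. -/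
def pre₂ : FockIndex → Option FockIndex
  | .word₂ 0 => some .vac₂
  | .word₂ (k + 1) => some (.word₂ k)
  | .word₁ (k + 1) => some (.word₁ k)
  | _ => none

theorem pre₁_inj (i j k : FockIndex) (hi : pre₁ i = some k) (hj : pre₁ j = some k) : i = j := by
  rcases i with _ | _ | (_ | i) | (_ | i) <;> rcases j with _ | _ | (_ | j) | (_ | j) <;>
    simp_all [pre₁]

theorem pre₂_inj (i j k : FockIndex) (hi : pre₂ i = some k) (hj : pre₂ j = some k) : i = j := by
  rcases i with _ | _ | (_ | i) | (_ | i) <;> rcases j with _ | _ | (_ | j) | (_ | j) <;>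
    simp_all [pre₂] <;> grind

/-- The creation operator `℘₁`: it sends `Ω₁` to `√β₁ e₁` and the other basis vectors to zero. -/
def create₁ (β₁ : ℝ) : Fock →L[ℂ] Fock := (√β₁ : ℂ) • shiftOp pre₁ pre₁_inj

/-- The creation operator `℘₂`: it sends `Ω₁` to zero, `Ω₂` to `√β₂ e₂`, and every other basis vector
`x` to `√β₂ e₂ ⊗ x`. -/
def create₂ (β₂ : ℝ) : Fock →L[ℂ] Fock := (√β₂ : ℂ) • shiftOp pre₂ pre₂_inj

/-- The sum `ω = ω₁ + ω₂` of the Gaussian operators `ω_j = ℘_j + ℘_j^*`. -/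
def gaussOp (β₁ β₂ : ℝ) : Fock →L[ℂ] Fock :=
  (create₁ β₁ + ContinuousLinearMap.adjoint (create₁ β₁)) +
    (create₂ β₂ + ContinuousLinearMap.adjoint (create₂ β₂))

/-- The operator `γ = (α₂ - α₁) (β₁⁻¹ ℘₁ ℘₁^* + β₂⁻¹ ℘₂ ℘₂^*) + α₁`. -/
def gammaOp (α₁ α₂ β₁ β₂ : ℝ) : Fock →L[ℂ] Fock :=
  ((α₂ - α₁ : ℝ) : ℂ) •
      (((β₁⁻¹ : ℝ) : ℂ) • (create₁ β₁ * ContinuousLinearMap.adjoint (create₁ β₁)) +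
        ((β₂⁻¹ : ℝ) : ℂ) • (create₂ β₂ * ContinuousLinearMap.adjoint (create₂ β₂))) +
    (α₁ : ℂ) • (1 : Fock →L[ℂ] Fock)

/-- The vector state `Ψ₁` defined by `Ω₁`. -/
def state₁ (T : Fock →L[ℂ] Fock) : ℂ := inner ℂ (vec .vac₁) (T (vec .vac₁))

/-! Free Meixner laws. -/

/-- The monic polynomials with Jacobi sequences `(a 0, a 1, …)` and `(b 0, b 1, …)`. -/
def jacobiPoly (a b : ℕ → ℝ) : ℕ → Polynomial ℝ
  | 0 => 1
  | 1 => Polynomial.X - Polynomial.C (a 0)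
  | k + 2 => (Polynomial.X - Polynomial.C (a (k + 1))) * jacobiPoly a b (k + 1) -
      Polynomial.C (b k) * jacobiPoly a b k

/-- `μ` is a probability measure on the real line with finite moments of all orders and with Jacobi
sequences `a`, `b`: its monic orthogonal polynomials are those of the three-term recurrence. -/
structure HasJacobiSequences (μ : Measure ℝ) (a b : ℕ → ℝ) : Prop where
  prob : IsProbabilityMeasure μ
  moments : ∀ m : ℕ, Integrable (fun x : ℝ => x ^ m) μ
  orthogonal : ∀ j k : ℕ, ∫ x, (jacobiPoly a b j).eval x * (jacobiPoly a b k).eval x ∂μ =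
    if j = k then ∏ i ∈ Finset.range k, b i else 0

/-- `μ` is the free Meixner law corresponding to `(α₁, α₂, β₁, β₂)`: its Jacobi sequences are
`(α₁, α₂, α₂, …)` and `(β₁, β₂, β₂, …)`. -/
def IsFreeMeixnerLaw (α₁ α₂ β₁ β₂ : ℝ) (μ : Measure ℝ) : Prop :=
  HasJacobiSequences μ (fun k => if k = 0 then α₁ else α₂) (fun k => if k = 0 then β₁ else β₂)

end

end FreeMeixner

open FreeMeixner

/-! Write `A` for `M(n)`. Gaussian integration by parts in the first factor of `A ^ (k + 1)` gives a
Schwinger–Dyson equation (`WickMatrix.E_pow_succ_mul`) for `E[(A^(k+1))_ii Q]`, where `Q` is a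
product of normalized traces of powers. Its main terms are the mean times `E[(A^k)_ii Q]` and `Σ_j
v_ij E[(A^a)_jj (A^(k-1-a))_ii Q]`. Since `n v_ij` depends only on the blocks and `|N_1|/n → 0`, the
sum over `j` is asymptotically `v_{p,2}` times a normalized trace, which joins `Q`; all other terms
are `O(1/n)`. Carrying `Q` through the induction (`tendsto_E_diag_mul_ntrProd`) yields factorization
in the limit without a separate concentration estimate. The limit of `E (A^k)_ii` thus depends only
on the block of `i`: on `N_2` it is the semicircle moment `φ_2(k)` with mean `α₂` and variance `β₂`,
and on `N_1` it satisfies `φ_1(k+1) = α₁ φ_1(k) + β₁ Σ_a φ_2(a) φ_1(k-1-a)`.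

As `N_1` may consist of a single index, all estimates are uniform in `i` and not merely averaged
over `[n]`. They rest on `norm_E_pow_diag_le`, a bound for `E (A^k)_ii` independent of `n`, obtained
by expanding over paths: a path with a non-loop edge used only once has zero expectation, and for
the others a factor `n^(1 - #vertices)` offsets the number of choices of the vertices.

On the operator side, `ω + γ` acts on `Ω₁, e₁, e₂ ⊗ e₁, …` as the Jacobi matrix of the two Jacobi
sequences. The generating functions of the recursions above solve the linear system for its matrix
elements (`inner_pow_jacobi`), which identifies the limit with the `Ψ₁`-moments. The spectral
measure at `Ω₁` is a free Meixner law. It is the only one because Jacobi sequences determine the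
moments, and the growth of the moments confines every candidate to a compact interval. -/

/-! ### The Jacobi operator on the Fock space. -/

theorem vec_apply (i j : FockIndex) : vec i j = if j = i then 1 else 0 := by
  simp only [vec, lp.coeFn_single]
  by_cases h : j = i
  · subst h; simp
  · simp [h]

theorem inner_vec_left (i : FockIndex) (x : Fock) : inner ℂ (vec i) x = x i := by
  simp [vec, lp.inner_single_left]

theorem inner_vec_right (i : FockIndex) (x : Fock) : inner ℂ x (vec i) = star (x i) := by
  rw [← inner_conj_symm, inner_vec_left]; rfl

theorem norm_vec (i : FockIndex) : ‖vec i‖ = 1 := by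
  simp [vec, lp.norm_single]

theorem shiftOp_apply (pre : FockIndex → Option FockIndex)
    (hpre : ∀ i j k, pre i = some k → pre j = some k → i = j) (x : Fock) (i : FockIndex) :
    shiftOp pre hpre x i = (pre i).elim 0 (fun j => x j) := rfl

/-- The map `pre` records the arrows of the shift backwards, and the adjoint follows them in that
direction. -/
theorem adjoint_shiftOp_vec (pre : FockIndex → Option FockIndex)
    (hpre : ∀ i j k, pre i = some k → pre j = some k → i = j) (i : FockIndex) :
    ContinuousLinearMap.adjoint (shiftOp pre hpre) (vec i) = (pre i).elim 0 vec := by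
  ext j
  rw [← inner_vec_left, ContinuousLinearMap.adjoint_inner_right, inner_vec_right, shiftOp_apply]
  cases h : pre i with
  | none => simp
  | some k =>
    simp only [Option.elim, vec_apply]
    rcases eq_or_ne k j with rfl | hk
    · simp
    · simp [hk, hk.symm]

/-- The Jacobi chain of basis vectors starting at the first vacuum vector. -/
def chainIndex : ℕ → FockIndex
  | 0 => .vac₁
  | k + 1 => .word₁ k

theorem chainIndex_injective : Function.Injective chainIndex := by
  intro a b h
  cases a <;> cases b <;> simp_all [chainIndex]

theorem shiftOp_pre₁_vec_vac₁ : shiftOp pre₁ pre₁_inj (vec .vac₁) = vec (.word₁ 0) := by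
  ext i
  rw [shiftOp_apply]
  rcases i with _ | _ | (_ | i) | i <;> simp [pre₁, vec_apply]

theorem shiftOp_pre₁_vec_word₁ (k : ℕ) : shiftOp pre₁ pre₁_inj (vec (.word₁ k)) = 0 := by
  ext i
  rw [shiftOp_apply]
  rcases i with _ | _ | (_ | i) | i <;> simp [pre₁, vec_apply]

theorem shiftOp_pre₂_vec_vac₁ : shiftOp pre₂ pre₂_inj (vec .vac₁) = 0 := by
  ext i
  rw [shiftOp_apply]
  rcases i with _ | _ | (_ | i) | (_ | i) <;> simp [pre₂, vec_apply]

theorem shiftOp_pre₂_vec_word₁ (k : ℕ) :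
    shiftOp pre₂ pre₂_inj (vec (.word₁ k)) = vec (.word₁ (k + 1)) := by
  ext i
  rw [shiftOp_apply]
  rcases i with _ | _ | (_ | i) | (_ | i) <;> simp [pre₂, vec_apply]

/-- The sum of the Gaussian operators and of the operator `γ`. -/
noncomputable def jacobiOp (α₁ α₂ β₁ β₂ : ℝ) : Fock →L[ℂ] Fock :=
  gaussOp β₁ β₂ + gammaOp α₁ α₂ β₁ β₂

theorem ofReal_sqrt_mul_self {β : ℝ} (h : 0 < β) : (√β : ℂ) * (√β : ℂ) = β := by
  rw [← Complex.ofReal_mul, Real.mul_self_sqrt h.le]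

/-- Each `β_j⁻¹ ℘_j ℘_j^*` is the projection onto the range of `℘_j`, so `γ` is diagonal: `α₁` at
the vacua and `α₂` on all words. Together with the raising and lowering parts of `ω` this leaves a
tridiagonal action on the chain starting at `Ω₁`. -/
theorem jacobiOp_vec_vac₁ {α₁ α₂ β₁ β₂ : ℝ} :
    jacobiOp α₁ α₂ β₁ β₂ (vec .vac₁) = (α₁ : ℂ) • vec .vac₁ + (√β₁ : ℂ) • vec (.word₁ 0) := by
  simp [-Complex.coe_smul, -Complex.real_smul, jacobiOp, gaussOp, gammaOp, create₁, create₂, adjoint_shiftOp_vec, pre₁, pre₂,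
    shiftOp_pre₁_vec_vac₁, shiftOp_pre₂_vec_vac₁, map_smulₛₗ]
  abel

theorem jacobiOp_vec_word₁_zero {α₁ α₂ β₁ β₂ : ℝ} (h₁ : 0 < β₁) :
    jacobiOp α₁ α₂ β₁ β₂ (vec (.word₁ 0)) =
      (√β₁ : ℂ) • vec .vac₁ + (α₂ : ℂ) • vec (.word₁ 0) + (√β₂ : ℂ) • vec (.word₁ 1) := by
  simp [-Complex.coe_smul, -Complex.real_smul, jacobiOp, gaussOp, gammaOp, create₁, create₂, adjoint_shiftOp_vec, pre₁, pre₂,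
    shiftOp_pre₁_vec_vac₁, shiftOp_pre₁_vec_word₁, shiftOp_pre₂_vec_word₁, map_smulₛₗ, smul_smul,
    ofReal_sqrt_mul_self h₁]
  rw [inv_mul_cancel₀ (by exact_mod_cast h₁.ne')]
  module

theorem jacobiOp_vec_word₁_succ {α₁ α₂ β₁ β₂ : ℝ} (h₂ : 0 < β₂) (k : ℕ) :
    jacobiOp α₁ α₂ β₁ β₂ (vec (.word₁ (k + 1))) =
      (√β₂ : ℂ) • vec (.word₁ k) + (α₂ : ℂ) • vec (.word₁ (k + 1)) +
        (√β₂ : ℂ) • vec (.word₁ (k + 2)) := by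
  simp [-Complex.coe_smul, -Complex.real_smul, jacobiOp, gaussOp, gammaOp, create₁, create₂, adjoint_shiftOp_vec, pre₁, pre₂,
    shiftOp_pre₁_vec_word₁, shiftOp_pre₂_vec_word₁, map_smulₛₗ, smul_smul,
    ofReal_sqrt_mul_self h₂]
  rw [inv_mul_cancel₀ (by exact_mod_cast h₂.ne')]
  module

theorem isSelfAdjoint_jacobiOp (α₁ α₂ β₁ β₂ : ℝ) : IsSelfAdjoint (jacobiOp α₁ α₂ β₁ β₂) := by
  have h : ∀ r : ℝ, IsSelfAdjoint (r : ℂ) := fun r => Complex.conj_ofReal r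
  simp only [jacobiOp, gaussOp, gammaOp, ← ContinuousLinearMap.star_eq_adjoint]
  refine .add (.add (.add_star_self _) (.add_star_self _)) (.add ?_ ((h _).smul (.one _)))
  exact (h _).smul (((h _).smul (.mul_star_self _)).add ((h _).smul (.mul_star_self _)))

/-! ### Spectral measures and orthogonal polynomials. -/

open scoped CompactlySupported in
/-- The spectral measure of a bounded self-adjoint operator at a vector. -/
theorem exists_spectralMeasure {H : Type*} [NormedAddCommGroup H] [InnerProductSpace ℂ H]
    [CompleteSpace H] (T : H →L[ℂ] H) (hT : IsSelfAdjoint T) (x : H) :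
    ∃ μ : Measure ℝ, IsFiniteMeasure μ ∧ (∀ᵐ t ∂μ, |t| ≤ ‖T‖) ∧
      ∀ p : Polynomial ℝ, ∫ t, p.eval t ∂μ = (inner ℂ x (Polynomial.aeval T p x)).re := by
  -- The measure comes from Riesz–Markov applied to `f ↦ Re ⟨x, f(T) x⟩`.
  let Λ₀ : C_c(spectrum ℝ T, ℝ) →ₗ[ℝ] ℝ :=
    { toFun := fun f => (inner ℂ x (cfcHom hT f.toContinuousMap x)).re
      map_add' := fun f g => by
        have : (f + g).toContinuousMap = f.toContinuousMap + g.toContinuousMap := rfl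
        rw [this, map_add]
        simp
      map_smul' := fun c f => by
        have : (c • f).toContinuousMap = c • f.toContinuousMap := rfl
        rw [this, map_smul]
        simp [inner_smul_right_eq_smul] }
  have hpos : ∀ f : C_c(spectrum ℝ T, ℝ), 0 ≤ f → 0 ≤ Λ₀ f := by
    intro f hf
    let g : C(spectrum ℝ T, ℝ) := ⟨fun t => √(f t), by fun_prop⟩
    -- With `g = √f`, the value of the functional is `‖g(T) x‖²`.
    have hg : f.toContinuousMap = star g * g := by
      ext t
      have : f t = √(f t) * √(f t) := (Real.mul_self_sqrt (hf t)).symm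
      exact this
    change 0 ≤ (inner ℂ x (cfcHom hT f.toContinuousMap x)).re
    rw [hg, map_mul, map_star, ContinuousLinearMap.star_eq_adjoint, mul_apply_eq_comp,
      ContinuousLinearMap.adjoint_inner_right]
    exact inner_self_nonneg (𝕜 := ℂ)
  let Λ : C_c(spectrum ℝ T, ℝ) →ₚ[ℝ] ℝ := PositiveLinearMap.mk₀ Λ₀ hpos
  have : CompactSpace (spectrum ℝ T) := isCompact_iff_compactSpace.1 (spectrum.isCompact T)
  refine ⟨(RealRMK.rieszMeasure Λ).map Subtype.val, inferInstance, ?_, ?_⟩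
  · rw [ae_map_iff (by fun_prop) (measurableSet_le (by fun_prop) measurable_const)]
    refine ae_of_all _ fun t => ?_
    -- The spectral bound by `‖T‖` needs `‖1‖ = 1`; on the zero space the spectrum is empty instead.
    rcases subsingleton_or_nontrivial H with h | h
    · exfalso
      obtain ⟨t, ht⟩ := t
      rw [spectrum.of_subsingleton] at ht
      exact ht
    · simpa using spectrum.norm_le_norm_of_mem t.2
  · intro p
    rw [integral_map (by fun_prop) (by fun_prop)]
    let f : C_c(spectrum ℝ T, ℝ) := ⟨p.toContinuousMapOn _, .of_compactSpace _⟩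
    have := RealRMK.integral_rieszMeasure Λ f
    refine this.trans ?_
    change (inner ℂ x (cfcHom hT (p.toContinuousMapOn _) x)).re = _
    congr 3
    have h1 : p.toContinuousMapOn (spectrum ℝ T) =
      Polynomial.aeval ((ContinuousMap.id ℝ).restrict (spectrum ℝ T)) p := by
      ext t; simp [Polynomial.aeval_def, Polynomial.toContinuousMapOn, Polynomial.eval₂_eq_sum_range, Polynomial.eval_eq_sum_range]
    rw [h1, ← Polynomial.aeval_algHom_apply (cfcHom hT : _ →⋆ₐ[ℝ] _), cfcHom_id hT]

theorem isSelfAdjoint_aeval {H : Type*} [NormedAddCommGroup H] [InnerProductSpace ℂ H]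
    [CompleteSpace H] {T : H →L[ℂ] H} (hT : IsSelfAdjoint T) (p : Polynomial ℝ) :
    IsSelfAdjoint (Polynomial.aeval T p) := by
  induction p using Polynomial.induction_on' with
  | add p q hp hq => rw [map_add]; exact hp.add hq
  | monomial n r =>
    rw [Polynomial.aeval_monomial, ← Algebra.smul_def]
    have h : r • T ^ n = (r : ℂ) • T ^ n := by ext x; simp
    rw [h]
    exact IsSelfAdjoint.smul (show IsSelfAdjoint (r : ℂ) from Complex.conj_ofReal r) (hT.pow n)

/-- The rescaled vectors `√(b 0 ⋯ b (k-1)) • v k` obey the three-term recurrence of the monic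
polynomials: the rescaling turns the symmetric weights `√(b k)` into the weights `1` and `b k`. -/
theorem aeval_jacobiPoly {H : Type*} [NormedAddCommGroup H] [InnerProductSpace ℂ H]
    (T : H →L[ℂ] H) (v : ℕ → H) (a b : ℕ → ℝ) (hb : ∀ k, 0 < b k)
    (h0 : T (v 0) = (a 0 : ℂ) • v 0 + (√(b 0) : ℂ) • v 1)
    (hs : ∀ k, T (v (k + 1)) =
      (√(b k) : ℂ) • v k + (a (k + 1) : ℂ) • v (k + 1) + (√(b (k + 1)) : ℂ) • v (k + 2))
    (k : ℕ) :
    Polynomial.aeval T (jacobiPoly a b k) (v 0) =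
      (√(∏ i ∈ Finset.range k, b i) : ℂ) • v k := by
  simp only [Complex.coe_smul] at h0 hs ⊢
  -- Two consecutive indices are carried along, as the recurrence has two steps.
  have key : ∀ k, Polynomial.aeval T (jacobiPoly a b k) (v 0) =
        √(∏ i ∈ Finset.range k, b i) • v k ∧
      Polynomial.aeval T (jacobiPoly a b (k + 1)) (v 0) =
        √(∏ i ∈ Finset.range (k + 1), b i) • v (k + 1) := by
    intro k
    induction k with
    | zero => simp [jacobiPoly, h0, Algebra.algebraMap_eq_smul_one]
    | succ k ih =>
      refine ⟨ih.2, ?_⟩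
      have hT : ∀ (r : ℝ) (x : H), T (r • x) = r • T x := fun r x => by
        simp
      have hk : 0 ≤ ∏ i ∈ Finset.range k, b i := Finset.prod_nonneg fun i _ => (hb i).le
      have hk1 : 0 ≤ ∏ i ∈ Finset.range (k + 1), b i := Finset.prod_nonneg fun i _ => (hb i).le
      have e1 : √(∏ i ∈ Finset.range (k + 1), b i) = √(∏ i ∈ Finset.range k, b i) * √(b k) := by
        rw [Finset.prod_range_succ, Real.sqrt_mul hk]
      have e2 : √(∏ i ∈ Finset.range (k + 2), b i) =
          √(∏ i ∈ Finset.range (k + 1), b i) * √(b (k + 1)) := by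
        rw [Finset.prod_range_succ, Real.sqrt_mul hk1]
      have e3 : √(b k) * √(b k) = b k := Real.mul_self_sqrt (hb k).le
      rw [jacobiPoly, map_sub, map_mul, map_mul, map_sub, Polynomial.aeval_X, Polynomial.aeval_C,
        Polynomial.aeval_C, Algebra.algebraMap_eq_smul_one, Algebra.algebraMap_eq_smul_one]
      simp only [sub_apply, mul_apply_eq_comp, ih.1, ih.2, hT, hs,
        smul_apply, one_apply_eq_self]
      rw [e2, e1]
      generalize √(b k) = r at e3 ⊢
      rw [← e3]
      module
  exact (key k).1

/-! ### Uniqueness of a measure with given Jacobi sequences. -/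

theorem integrable_polynomial_eval {μ : Measure ℝ} (h : ∀ m : ℕ, Integrable (fun x : ℝ => x ^ m) μ)
    (p : Polynomial ℝ) : Integrable (fun x => p.eval x) μ := by
  simp only [Polynomial.eval_eq_sum_range]
  exact integrable_finsetSum _ fun i _ => (h i).const_mul _

/-- The recurrence rewrites `x * P_k` through `P_(k+1)`, `P_k` and `P_(k-1)`, so powers of `x` can
be removed one by one; at `m = 0` the value of `∫ P_k` is prescribed by orthogonality to `P_0`. -/
theorem integral_pow_mul_jacobiPoly_eq {a b : ℕ → ℝ} {μ ν : Measure ℝ}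
    (hμ : HasJacobiSequences μ a b) (hν : HasJacobiSequences ν a b) (m : ℕ) (k : ℕ) :
    ∫ x, x ^ m * (jacobiPoly a b k).eval x ∂μ = ∫ x, x ^ m * (jacobiPoly a b k).eval x ∂ν := by
  induction m generalizing k with
  | zero =>
    have h1 := hμ.orthogonal 0 k
    have h2 := hν.orthogonal 0 k
    simp only [jacobiPoly, Polynomial.eval_one] at h1 h2
    simp only [pow_zero]
    rw [h1, h2]
  | succ m ih =>
    have hint : ∀ {ρ : Measure ℝ}, HasJacobiSequences ρ a b → ∀ k : ℕ,
        Integrable (fun x => x ^ m * (jacobiPoly a b k).eval x) ρ := fun {ρ} hρ k =>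
      (integrable_polynomial_eval hρ.moments (Polynomial.X ^ m * jacobiPoly a b k)).congr
        (ae_of_all _ fun x => by simp only [Polynomial.eval_mul, Polynomial.eval_pow,
          Polynomial.eval_X])
    cases k with
    | zero =>
      have hx : ∀ x : ℝ, x ^ (m + 1) * (jacobiPoly a b 0).eval x =
          x ^ m * (jacobiPoly a b 1).eval x + a 0 * (x ^ m * (jacobiPoly a b 0).eval x) := by
        intro x; simp [jacobiPoly]; ring
      simp only [hx]
      rw [integral_add (hint hμ _) ((hint hμ _).const_mul _), integral_add (hint hν _)
        ((hint hν _).const_mul _), integral_const_mul, integral_const_mul, ih, ih]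
    | succ k =>
      have hx : ∀ x : ℝ, x ^ (m + 1) * (jacobiPoly a b (k + 1)).eval x =
          x ^ m * (jacobiPoly a b (k + 2)).eval x +
            (a (k + 1) * (x ^ m * (jacobiPoly a b (k + 1)).eval x) +
              b k * (x ^ m * (jacobiPoly a b k).eval x)) := by
        intro x; simp [jacobiPoly]; ring
      simp only [hx]
      have hadd : ∀ {ρ : Measure ℝ}, HasJacobiSequences ρ a b →
          Integrable (fun x => a (k + 1) * (x ^ m * (jacobiPoly a b (k + 1)).eval x) +
            b k * (x ^ m * (jacobiPoly a b k).eval x)) ρ := fun {ρ} hρ =>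
        ((hint hρ _).const_mul _).add ((hint hρ _).const_mul _)
      rw [integral_add (hint hμ _) (hadd hμ),
        integral_add ((hint hμ _).const_mul _) ((hint hμ _).const_mul _),
        integral_add (hint hν _) (hadd hν),
        integral_add ((hint hν _).const_mul _) ((hint hν _).const_mul _)]
      simp only [integral_const_mul, ih]

theorem moments_eq_of_hasJacobiSequences {a b : ℕ → ℝ} {μ ν : Measure ℝ}
    (hμ : HasJacobiSequences μ a b) (hν : HasJacobiSequences ν a b) (m : ℕ) :
    ∫ x, x ^ m ∂μ = ∫ x, x ^ m ∂ν := by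
  simpa [jacobiPoly] using integral_pow_mul_jacobiPoly_eq hμ hν m 0

/-- A finite measure whose moments grow at most geometrically has bounded support. -/
theorem ae_abs_le_of_integral_pow_le {ν : Measure ℝ} [IsFiniteMeasure ν]
    (hm : ∀ m : ℕ, Integrable (fun x : ℝ => x ^ m) ν) {C R : ℝ} (hR : 0 ≤ R)
    (h : ∀ m : ℕ, ∫ x, x ^ (2 * m) ∂ν ≤ C * R ^ (2 * m)) : ∀ᵐ x ∂ν, |x| ≤ R := by
  have hS : ∀ S > R, ν {x | S ≤ |x|} = 0 := by
    intro S hS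
    have hS0 : 0 < S := hR.trans_lt hS
    -- Markov's inequality for `x ^ (2 * m)`; the right side tends to zero as `m` grows because `R <
    -- S`.
    have hle : ∀ m : ℕ, ν.real {x | S ≤ |x|} ≤ C * ((R / S) ^ 2) ^ m := by
      intro m
      have hset : {x : ℝ | S ≤ |x|} ⊆ {x | S ^ (2 * m) ≤ x ^ (2 * m)} := by
        intro x hx
        have : S ^ (2 * m) ≤ |x| ^ (2 * m) := pow_le_pow_left₀ hS0.le hx _
        rwa [(even_two_mul m).pow_abs] at this
      have h1 := mul_meas_ge_le_integral_of_nonneg (μ := ν) (f := fun x : ℝ => x ^ (2 * m))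
        (ae_of_all _ fun x => (even_two_mul m).pow_nonneg x) (hm _) (S ^ (2 * m))
      have h2 := measureReal_mono (μ := ν) hset
      have hp : 0 < S ^ (2 * m) := by positivity
      have h3 : S ^ (2 * m) * ν.real {x | S ≤ |x|} ≤ C * R ^ (2 * m) :=
        (mul_le_mul_of_nonneg_left h2 hp.le).trans (h1.trans (h m))
      rw [← pow_mul, div_pow, mul_div_assoc', le_div_iff₀ hp, mul_comm]
      exact h3
    have hlim : Tendsto (fun m : ℕ => C * ((R / S) ^ 2) ^ m) atTop (𝓝 (C * 0)) := by
      refine (tendsto_pow_atTop_nhds_zero_of_lt_one (by positivity) ?_).const_mul C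
      exact pow_lt_one₀ (by positivity) ((div_lt_one hS0).2 hS) two_ne_zero
    rw [mul_zero] at hlim
    have := le_antisymm (ge_of_tendsto' hlim hle) measureReal_nonneg
    rwa [measureReal_eq_zero_iff] at this
  rw [ae_iff]
  have hU : {x : ℝ | ¬|x| ≤ R} ⊆ ⋃ k : ℕ, {x | R + 1 / ((k : ℝ) + 1) ≤ |x|} := by
    intro x hx
    simp only [Set.mem_ofPred_eq, not_le] at hx
    obtain ⟨k, hk⟩ := exists_nat_one_div_lt (sub_pos.2 hx)
    exact Set.mem_iUnion.2 ⟨k, by simp only [Set.mem_ofPred_eq]; linarith⟩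
  refine measure_mono_null hU (measure_iUnion_null fun k => hS _ ?_)
  have : (0 : ℝ) < 1 / ((k : ℝ) + 1) := by positivity
  linarith

/-- By Weierstrass approximation on `[-R, R]`, polynomial integrals determine the integrals of
bounded continuous functions. -/
theorem measure_ext_of_moments {μ ν : Measure ℝ} [IsFiniteMeasure μ] [IsFiniteMeasure ν]
    {R : ℝ} (hμ : ∀ᵐ x ∂μ, |x| ≤ R) (hν : ∀ᵐ x ∂ν, |x| ≤ R)
    (hμm : ∀ m : ℕ, Integrable (fun x : ℝ => x ^ m) μ)
    (hνm : ∀ m : ℕ, Integrable (fun x : ℝ => x ^ m) ν)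
    (h : ∀ m : ℕ, ∫ x, x ^ m ∂μ = ∫ x, x ^ m ∂ν) : μ = ν := by
  have hp : ∀ p : Polynomial ℝ, ∫ x, p.eval x ∂μ = ∫ x, p.eval x ∂ν := by
    intro p
    simp only [Polynomial.eval_eq_sum_range]
    rw [integral_finsetSum _ fun i _ => (hμm i).const_mul _,
      integral_finsetSum _ fun i _ => (hνm i).const_mul _]
    simp only [integral_const_mul, h]
  refine ext_of_forall_integral_eq_of_IsFiniteMeasure fun f => ?_
  have hb : ∀ {ρ : Measure ℝ} [IsFiniteMeasure ρ], (∀ᵐ x ∂ρ, |x| ≤ R) →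
      (∀ m : ℕ, Integrable (fun x : ℝ => x ^ m) ρ) → ∀ (p : Polynomial ℝ) (ε : ℝ),
      (∀ x ∈ Set.Icc (-R) R, |p.eval x - f x| < ε) →
      |∫ x, p.eval x ∂ρ - ∫ x, f x ∂ρ| ≤ ε * ρ.real Set.univ := by
    intro ρ _ hρ hρm p ε hε
    rw [← integral_sub (integrable_polynomial_eval hρm p) (f.integrable ρ), ← Real.norm_eq_abs]
    refine norm_integral_le_of_norm_le_const ?_
    filter_upwards [hρ] with x hx
    exact (hε x (abs_le.1 hx)).le
  have hle : ∀ ε > 0, |∫ x, f x ∂μ - ∫ x, f x ∂ν| ≤ ε * (μ.real Set.univ + ν.real Set.univ) := by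
    intro ε hε
    obtain ⟨p, hpε⟩ := exists_polynomial_near_of_continuousOn (-R) R f f.continuous.continuousOn ε hε
    have h1 := hb hμ hμm p ε hpε
    have h2 := hb hν hνm p ε hpε
    rw [hp] at h1
    rw [abs_le] at *
    constructor <;> linarith [h1.1, h1.2, h2.1, h2.2]
  have hz : |∫ x, f x ∂μ - ∫ x, f x ∂ν| ≤ 0 := by
    have hc : Tendsto (fun ε : ℝ => ε * (μ.real Set.univ + ν.real Set.univ)) (𝓝[>] 0)
        (𝓝 (0 * (μ.real Set.univ + ν.real Set.univ))) :=
      ((continuous_id.mul continuous_const).tendsto 0).mono_left nhdsWithin_le_nhds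
    rw [zero_mul] at hc
    exact ge_of_tendsto hc (eventually_mem_nhdsWithin.mono hle)
  exact sub_eq_zero.1 (abs_nonpos_iff.1 hz)

/-! ### Moment recursions and generating functions. -/

/-- The moments of the semicircle law with mean `α` and variance `β`. -/
noncomputable def semicircleMoment (α β : ℝ) : ℕ → ℝ
  | 0 => 1
  | k + 1 => α * semicircleMoment α β k +
      β * ∑ a : Fin k, semicircleMoment α β a * semicircleMoment α β (k - 1 - a)

/-- The moments of the free Meixner law with Jacobi sequences `(α₁, α₂, α₂, …)` and
`(β₁, β₂, β₂, …)`. -/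
noncomputable def meixnerMoment (α₁ α₂ β₁ β₂ : ℝ) : ℕ → ℝ
  | 0 => 1
  | k + 1 => α₁ * meixnerMoment α₁ α₂ β₁ β₂ k +
      β₁ * ∑ a : Fin k, semicircleMoment α₂ β₂ a * meixnerMoment α₁ α₂ β₁ β₂ (k - 1 - a)

theorem semicircleMoment_zero (α β : ℝ) : semicircleMoment α β 0 = 1 := by
  rw [semicircleMoment]

theorem semicircleMoment_succ (α β : ℝ) (k : ℕ) :
    semicircleMoment α β (k + 1) = α * semicircleMoment α β k +
      β * ∑ a ∈ Finset.range k, semicircleMoment α β a * semicircleMoment α β (k - 1 - a) := by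
  rw [semicircleMoment, ← Fin.sum_univ_eq_sum_range
    (fun a => semicircleMoment α β a * semicircleMoment α β (k - 1 - a)) k]

theorem meixnerMoment_zero (α₁ α₂ β₁ β₂ : ℝ) : meixnerMoment α₁ α₂ β₁ β₂ 0 = 1 := by
  rw [meixnerMoment]

theorem meixnerMoment_succ (α₁ α₂ β₁ β₂ : ℝ) (k : ℕ) :
    meixnerMoment α₁ α₂ β₁ β₂ (k + 1) = α₁ * meixnerMoment α₁ α₂ β₁ β₂ k +
      β₁ * ∑ a ∈ Finset.range k,
        semicircleMoment α₂ β₂ a * meixnerMoment α₁ α₂ β₁ β₂ (k - 1 - a) := by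
  rw [meixnerMoment, ← Fin.sum_univ_eq_sum_range
    (fun a => semicircleMoment α₂ β₂ a * meixnerMoment α₁ α₂ β₁ β₂ (k - 1 - a)) k]

/-- In terms of generating functions the recursion reads `F = 1 + z (α F + β z G F)`. The inner sum
is empty at `k = 0`, so the truncated `k - 1` does no harm. -/
theorem powerSeries_mk_eq_of_conv_rec {f g : ℕ → ℝ} {α β : ℝ} (h0 : f 0 = 1)
    (hs : ∀ k, f (k + 1) = α * f k + β * ∑ a ∈ Finset.range k, g a * f (k - 1 - a)) :
    PowerSeries.mk f = 1 + PowerSeries.X * (PowerSeries.C α * PowerSeries.mk f +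
      PowerSeries.C β * (PowerSeries.X * (PowerSeries.mk g * PowerSeries.mk f))) := by
  ext k
  rcases k with _ | k
  · simp [h0]
  · rw [map_add, PowerSeries.coeff_succ_X_mul, map_add, PowerSeries.coeff_C_mul,
      PowerSeries.coeff_C_mul, PowerSeries.coeff_mk, PowerSeries.coeff_mk, hs]
    rcases k with _ | k
    · simp [PowerSeries.coeff_one]
    · rw [PowerSeries.coeff_succ_X_mul, PowerSeries.coeff_mul,
        Finset.Nat.sum_antidiagonal_eq_sum_range_succ_mk]
      simp [PowerSeries.coeff_one]

/-- The matrix elements `⟨v j, T ^ m v 0⟩` of a Jacobi operator with eventually constant Jacobi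
sequences. -/
theorem inner_pow_jacobi {H : Type*} [NormedAddCommGroup H] [InnerProductSpace ℂ H]
    [CompleteSpace H] (T : H →L[ℂ] H) (hT : IsSelfAdjoint T) (v : ℕ → H) (hv : Orthonormal ℂ v)
    {α₁ α₂ β₁ β₂ : ℝ} (hβ₁ : 0 < β₁) (hβ₂ : 0 < β₂)
    (h0 : T (v 0) = (α₁ : ℂ) • v 0 + (√β₁ : ℂ) • v 1)
    (h1 : T (v 1) = (√β₁ : ℂ) • v 0 + (α₂ : ℂ) • v 1 + (√β₂ : ℂ) • v 2)
    (h2 : ∀ k, T (v (k + 2)) =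
      (√β₂ : ℂ) • v (k + 1) + (α₂ : ℂ) • v (k + 2) + (√β₂ : ℂ) • v (k + 3)) (m : ℕ) :
    inner ℂ (v 0) ((T ^ m) (v 0)) = (meixnerMoment α₁ α₂ β₁ β₂ m : ℂ) := by
  set F₁ := PowerSeries.mk (meixnerMoment α₁ α₂ β₁ β₂) with hF₁
  set F₂ := PowerSeries.mk (semicircleMoment α₂ β₂) with hF₂
  have e₁ : F₁ = 1 + PowerSeries.X * (PowerSeries.C α₁ * F₁ +
      PowerSeries.C β₁ * (PowerSeries.X * (F₂ * F₁))) :=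
    powerSeries_mk_eq_of_conv_rec (meixnerMoment_zero _ _ _ _) (meixnerMoment_succ _ _ _ _)
  have e₂ : F₂ = 1 + PowerSeries.X * (PowerSeries.C α₂ * F₂ +
      PowerSeries.C β₂ * (PowerSeries.X * (F₂ * F₂))) :=
    powerSeries_mk_eq_of_conv_rec (semicircleMoment_zero _ _) (semicircleMoment_succ _ _)
  -- Motzkin paths from height `0` to height `k`, split at their last visits to the heights `0, …, k
  -- - 1`: an `F₁` excursion at the bottom, then `k` rises, each followed by an `F₂` excursion.
  let W : ℕ → PowerSeries ℝ := fun k => PowerSeries.X ^ k * F₁ * F₂ ^ k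
  have hW0 : W 0 = 1 + PowerSeries.X * (PowerSeries.C α₁ * W 0 + PowerSeries.C β₁ * W 1) := by
    simp only [W, pow_zero, mul_one, one_mul, pow_one]
    nth_rw 1 [e₁]
    ring
  have hW : ∀ k, W (k + 1) = PowerSeries.X * (W k + PowerSeries.C α₂ * W (k + 1) +
      PowerSeries.C β₂ * W (k + 2)) := by
    intro k
    have : W (k + 1) = PowerSeries.X ^ (k + 1) * F₁ * F₂ ^ k * F₂ := by
      simp only [W]; ring
    rw [this]
    nth_rw 2 [e₂]
    simp only [W]
    ring
  -- `W` gives weight `1` to rises and the full `β` to falls, whereas `T` gives `√β` to both; for a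
  -- path ending at height `j` the ratio of the two weights is `p j`.
  let p : ℕ → ℝ := fun j => if j = 0 then 1 else √β₁ * √β₂ ^ (j - 1)
  have s₁ : √β₁ * √β₁ = β₁ := Real.mul_self_sqrt hβ₁.le
  have s₂ : √β₂ * √β₂ = β₂ := Real.mul_self_sqrt hβ₂.le
  have hinner : ∀ x y : H, inner ℂ x (T y) = inner ℂ (T x) y := fun x y => by
    rw [← ContinuousLinearMap.adjoint_inner_left, hT.adjoint_eq]
  have hsm : ∀ (r : ℝ) (x y : H), inner ℂ ((r : ℂ) • x) y = (r : ℂ) * inner ℂ x y := fun r x y => by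
    rw [inner_smul_left, Complex.conj_ofReal]
  have hc0 : ∀ m, PowerSeries.coeff (m + 1) (W 0) =
      α₁ * PowerSeries.coeff m (W 0) + β₁ * PowerSeries.coeff m (W 1) := fun m => by
    nth_rw 1 [hW0]
    simp [PowerSeries.coeff_one, PowerSeries.coeff_succ_X_mul]
  have hcs : ∀ m k, PowerSeries.coeff (m + 1) (W (k + 1)) = PowerSeries.coeff m (W k) +
      α₂ * PowerSeries.coeff m (W (k + 1)) + β₂ * PowerSeries.coeff m (W (k + 2)) := fun m k => by
    nth_rw 1 [hW]
    simp [PowerSeries.coeff_succ_X_mul]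
  have key : ∀ m j, inner ℂ (v j) ((T ^ m) (v 0)) = ((p j * PowerSeries.coeff m (W j) : ℝ) : ℂ) := by
    intro m
    induction m with
    | zero =>
      intro j
      rcases j with _ | j
      · rw [hW0]
        simp [p, hv.1 0]
      · rw [hW]
        simp [p, hv.2 (Nat.succ_ne_zero j)]
    | succ m ih =>
      intro j
      rw [pow_succ', mul_apply_eq_comp, hinner]
      rcases j with _ | _ | j
      · rw [h0, inner_add_left, hsm, hsm, ih, ih, hc0]
        simp only [← Complex.ofReal_mul, ← Complex.ofReal_add]
        congr 1
        simp [p]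
        linear_combination (PowerSeries.coeff m (W 1)) * s₁
      · rw [h1, inner_add_left, inner_add_left, hsm, hsm, hsm, ih, ih, ih, hcs]
        simp only [← Complex.ofReal_mul, ← Complex.ofReal_add]
        congr 1
        simp [p]
        linear_combination (√β₁ * PowerSeries.coeff m (W 2)) * s₂
      · rw [h2, inner_add_left, inner_add_left, hsm, hsm, hsm, ih, ih, ih, hcs]
        simp only [← Complex.ofReal_mul, ← Complex.ofReal_add]
        congr 1
        simp [p]
        linear_combination (√β₁ * √β₂ ^ (j + 1) * PowerSeries.coeff m (W (j + 3))) * s₂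
  rw [key]
  simp [p, W, hF₁]

theorem jacobiOp_chain {α₁ α₂ β₁ β₂ : ℝ} (hβ₁ : 0 < β₁) (hβ₂ : 0 < β₂) :
    jacobiOp α₁ α₂ β₁ β₂ (vec (chainIndex 0)) =
        (α₁ : ℂ) • vec (chainIndex 0) + (√β₁ : ℂ) • vec (chainIndex 1) ∧
      jacobiOp α₁ α₂ β₁ β₂ (vec (chainIndex 1)) =
        (√β₁ : ℂ) • vec (chainIndex 0) + (α₂ : ℂ) • vec (chainIndex 1) + (√β₂ : ℂ) • vec (chainIndex 2) ∧
      ∀ k, jacobiOp α₁ α₂ β₁ β₂ (vec (chainIndex (k + 2))) =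
        (√β₂ : ℂ) • vec (chainIndex (k + 1)) + (α₂ : ℂ) • vec (chainIndex (k + 2)) +
          (√β₂ : ℂ) • vec (chainIndex (k + 3)) := by
  exact ⟨jacobiOp_vec_vac₁, jacobiOp_vec_word₁_zero hβ₁, fun k => jacobiOp_vec_word₁_succ hβ₂ k⟩

theorem orthonormal_vec_chainIndex : Orthonormal ℂ fun k => vec (chainIndex k) := by
  refine ⟨fun k => norm_vec _, fun i j h => ?_⟩
  change inner ℂ (vec (chainIndex i)) (vec (chainIndex j)) = 0
  rw [inner_vec_left, vec_apply, if_neg fun h' => h (chainIndex_injective h')]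

theorem state₁_jacobiOp_pow {α₁ α₂ β₁ β₂ : ℝ} (hβ₁ : 0 < β₁) (hβ₂ : 0 < β₂) (m : ℕ) :
    state₁ (jacobiOp α₁ α₂ β₁ β₂ ^ m) = (meixnerMoment α₁ α₂ β₁ β₂ m : ℂ) := by
  obtain ⟨h0, h1, h2⟩ := jacobiOp_chain (α₁ := α₁) (α₂ := α₂) hβ₁ hβ₂
  exact inner_pow_jacobi _ (isSelfAdjoint_jacobiOp _ _ _ _) (fun k => vec (chainIndex k))
    orthonormal_vec_chainIndex hβ₁ hβ₂ h0 h1 h2 m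

/-- Existence and uniqueness of the free Meixner law, and its realization by a Jacobi operator. -/
theorem exists_isFreeMeixnerLaw {α₁ α₂ β₁ β₂ : ℝ} (hβ₁ : 0 < β₁) (hβ₂ : 0 < β₂) :
    ∃ μ : Measure ℝ, IsFreeMeixnerLaw α₁ α₂ β₁ β₂ μ ∧
      (∀ ν : Measure ℝ, IsFreeMeixnerLaw α₁ α₂ β₁ β₂ ν → ν = μ) ∧
      ∀ m : ℕ, state₁ (jacobiOp α₁ α₂ β₁ β₂ ^ m) = ((∫ x, x ^ m ∂μ : ℝ) : ℂ) := by
  have hT := isSelfAdjoint_jacobiOp α₁ α₂ β₁ β₂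
  obtain ⟨h0, h1, h2⟩ := jacobiOp_chain (α₁ := α₁) (α₂ := α₂) hβ₁ hβ₂
  have hs := state₁_jacobiOp_pow (α₁ := α₁) (α₂ := α₂) hβ₁ hβ₂
  generalize jacobiOp α₁ α₂ β₁ β₂ = T at *
  obtain ⟨μ, hfin, hbdd, hint⟩ := exists_spectralMeasure T hT (vec (chainIndex 0))
  have hpow : ∀ m : ℕ, Integrable (fun x : ℝ => x ^ m) μ := fun m => by
    refine Integrable.of_bound (by fun_prop) (‖T‖ ^ m) ?_
    filter_upwards [hbdd] with x hx
    rw [norm_pow]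
    exact pow_le_pow_left₀ (norm_nonneg _) hx m
  have hprob : IsProbabilityMeasure μ := by
    have := hint 1
    simp only [Polynomial.eval_one, integral_const, smul_eq_mul, mul_one, map_one,
      one_apply_eq_self, inner_self_eq_norm_sq_to_K, norm_vec] at this
    rw [isProbabilityMeasure_iff_real]
    simpa using this
  have hμ : IsFreeMeixnerLaw α₁ α₂ β₁ β₂ μ := by
    refine ⟨hprob, hpow, fun j k => ?_⟩
    -- Since `P_k(T) Ω₁` is a multiple of the `k`-th chain vector, orthogonality of the polynomials
    -- becomes orthonormality of the chain.
    have hP := aeval_jacobiPoly T (fun k => vec (chainIndex k)) (fun k => if k = 0 then α₁ else α₂)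
      (fun k => if k = 0 then β₁ else β₂) (fun k => by split_ifs <;> assumption)
      (by simpa only [if_true] using h0) (fun k => by
        rcases k with _ | k
        · simpa using h1
        · simpa using h2 k)
    have h := hint (jacobiPoly (fun k => if k = 0 then α₁ else α₂)
      (fun k => if k = 0 then β₁ else β₂) j * jacobiPoly (fun k => if k = 0 then α₁ else α₂)
      (fun k => if k = 0 then β₁ else β₂) k)
    simp only [Polynomial.eval_mul] at h
    rw [h, map_mul, mul_apply_eq_comp, ← ContinuousLinearMap.adjoint_inner_left,
      (isSelfAdjoint_aeval hT _).adjoint_eq, hP, hP,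
      inner_smul_left, inner_smul_right, orthonormal_iff_ite.1 orthonormal_vec_chainIndex,
      Complex.conj_ofReal]
    split_ifs with hjk
    · subst hjk
      rw [mul_one, ← Complex.ofReal_mul, Complex.ofReal_re, Real.mul_self_sqrt]
      exact Finset.prod_nonneg fun i _ => by split_ifs <;> positivity
    · simp
  refine ⟨μ, hμ, fun ν hν => ?_, fun m => ?_⟩
  · have := hν.prob
    have hmom := moments_eq_of_hasJacobiSequences hν hμ
    -- The competitor `ν` is not assumed to have bounded support; its moments equal those of `μ`,
    -- and their growth forces the same bound.
    have hνb : ∀ᵐ x ∂ν, |x| ≤ ‖T‖ := by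
      refine ae_abs_le_of_integral_pow_le (C := 1) hν.moments (norm_nonneg T) fun m => ?_
      rw [hmom, one_mul]
      refine (integral_mono_ae (hpow _) (integrable_const (‖T‖ ^ (2 * m))) ?_).trans (by simp)
      filter_upwards [hbdd] with x hx
      rw [← (even_two_mul m).pow_abs]
      exact pow_le_pow_left₀ (abs_nonneg x) hx _
    exact measure_ext_of_moments hνb hbdd hν.moments hpow hmom
  · have h := hint (Polynomial.X ^ m)
    simp only [Polynomial.eval_pow, Polynomial.eval_X, map_pow, Polynomial.aeval_X] at h
    have h' : ∫ x, x ^ m ∂μ = (state₁ (T ^ m)).re := h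
    rw [h', hs, Complex.ofReal_re]

/-! ### Gaussian integration by parts -/

theorem integrable_pow_gaussianReal (s : ℝ≥0) (k : ℕ) :
    Integrable (fun x : ℝ => x ^ k) (gaussianReal 0 s) := by
  have h := (memLp_id_gaussianReal' (μ := 0) (v := s) (k : ℝ≥0∞) (by simp)).integrable_norm_pow'
  refine (integrable_norm_iff (by fun_prop)).1 ?_
  simpa [norm_pow] using h

/-- Integration by parts, since the density has derivative `-(x / s)` times itself. For `s = 0` the
law is a point mass at zero and both sides vanish; for `k = 0` the factor `k` makes the truncated
exponent harmless. -/
theorem integral_mul_pow_gaussianReal (s : ℝ≥0) (k : ℕ) :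
    ∫ x, x * x ^ k ∂(gaussianReal 0 s) = s * (k * ∫ x, x ^ (k - 1) ∂(gaussianReal 0 s)) := by
  rcases eq_or_ne s 0 with rfl | hs
  · simp
  have hint : ∀ j : ℕ, Integrable (fun x : ℝ => x ^ j * gaussianPDFReal 0 s x) := fun j => by
    have h := integrable_pow_gaussianReal s j
    rw [gaussianReal_of_var_ne_zero _ hs, integrable_withDensity_iff (by fun_prop)
      (ae_of_all _ fun _ => gaussianPDF_lt_top)] at h
    simpa only [toReal_gaussianPDF] using h
  have hs' : (s : ℝ) ≠ 0 := by exact_mod_cast hs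
  have hderiv : ∀ x : ℝ, HasDerivAt (gaussianPDFReal 0 s)
      (-(x / s) * gaussianPDFReal 0 s x) x := fun x => by
    rw [gaussianPDFReal_def]
    have h1 : HasDerivAt (fun x : ℝ => -(x - 0) ^ 2 / (2 * (s : ℝ))) (-(x / s)) x := by
      have := (((hasDerivAt_id x).sub_const 0).pow 2).neg.div_const (2 * (s : ℝ))
      refine this.congr_deriv ?_
      simp
      field_simp
    refine (h1.exp.const_mul _).congr_deriv ?_
    ring
  have h := integral_mul_deriv_eq_deriv_mul_of_integrable (u := fun x : ℝ => x ^ k)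
    (u' := fun x => k * x ^ (k - 1)) (v := gaussianPDFReal 0 s)
    (v' := fun x => -(x / s) * gaussianPDFReal 0 s x) (fun x _ => hasDerivAt_pow k x)
    (fun x _ => hderiv x)
    (((hint (k + 1)).const_mul (-(s : ℝ)⁻¹)).congr (ae_of_all _ fun x => by
      simp only [Pi.mul_apply]; field_simp; ring))
    (((hint (k - 1)).const_mul k).congr (ae_of_all _ fun x => by
      simp only [Pi.mul_apply]; ring))
    (hint k)
  rw [integral_gaussianReal_eq_integral_smul hs, integral_gaussianReal_eq_integral_smul hs]
  have e1 : ∫ x, x ^ k * (-(x / s) * gaussianPDFReal 0 s x) =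
      -(s : ℝ)⁻¹ * ∫ x, gaussianPDFReal 0 s x • (x * x ^ k) := by
    rw [← integral_const_mul]
    congr 1; ext x; simp only [smul_eq_mul]; field_simp
  have e2 : ∫ x, k * x ^ (k - 1) * gaussianPDFReal 0 s x =
      k * ∫ x, gaussianPDFReal 0 s x • x ^ (k - 1) := by
    rw [← integral_const_mul]
    congr 1; ext x; simp only [smul_eq_mul]; ring
  rw [e1, e2] at h
  field_simp at h
  linarith

/-- Random variables with finite absolute moments of all orders. -/
def HasMoments {Ω E : Type*} [MeasurableSpace Ω] [NormedAddCommGroup E] (P : Measure Ω)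
    (f : Ω → E) : Prop :=
  ∀ k : ℕ, MemLp f k P

namespace HasMoments

variable {Ω : Type*} [MeasurableSpace Ω] {P : Measure Ω}

theorem const [IsFiniteMeasure P] (c : ℂ) : HasMoments P fun _ => c := fun _ => memLp_const c

theorem add {f g : Ω → ℂ} (hf : HasMoments P f) (hg : HasMoments P g) :
    HasMoments P fun ω => f ω + g ω := fun k => (hf k).add (hg k)

theorem mul {f g : Ω → ℂ} (hf : HasMoments P f) (hg : HasMoments P g) :
    HasMoments P fun ω => f ω * g ω := fun k => by
  have : ENNReal.HolderTriple ((2 * k : ℕ) : ℝ≥0∞) ((2 * k : ℕ) : ℝ≥0∞) (k : ℝ≥0∞) := by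
    constructor
    push_cast
    rw [ENNReal.mul_inv (by simp) (by simp), ← two_mul, ← mul_assoc,
      ENNReal.mul_inv_cancel (by simp) (by simp), one_mul]
  exact (hg (2 * k)).mul' (hf (2 * k))

theorem integrable {f : Ω → ℂ} (hf : HasMoments P f) : Integrable f P := by
  exact memLp_one_iff_integrable.1 (by simpa using hf 1)

theorem integrable_norm_pow [IsFiniteMeasure P] {f : Ω → ℂ} (hf : HasMoments P f) (k : ℕ) :
    Integrable (fun ω => ‖f ω‖ ^ k) P := (hf k).integrable_norm_pow'

end HasMoments

section Polynomial

variable {Ω : Type*} [MeasurableSpace Ω] {P : Measure Ω} [IsProbabilityMeasure P]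
  {ι : Type*} {g : ι → Ω → ℝ} {s : ι → ℝ≥0}

theorem hasMoments_of_hasLaw_gaussianReal {X : Ω → ℝ} {v : ℝ≥0}
    (h : HasLaw X (gaussianReal 0 v) P) : HasMoments P fun ω => (X ω : ℂ) := fun k => by
  have := (memLp_id_gaussianReal' (μ := 0) (v := v) (k : ℝ≥0∞) (by simp))
  rw [← h.map_eq, memLp_map_measure_iff (by fun_prop) h.aemeasurable] at this
  exact this.ofReal

theorem hasMoments_mvPolynomial_eval (hg : ∀ t, HasLaw (g t) (gaussianReal 0 (s t)) P)
    (p : MvPolynomial ι ℂ) :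
    HasMoments P fun ω => MvPolynomial.eval (fun t => (g t ω : ℂ)) p := by
  induction p using MvPolynomial.induction_on with
  | C a => simpa using HasMoments.const a
  | add p q hp hq => simpa using hp.add hq
  | mul_X p t hp => simpa using hp.mul (hasMoments_of_hasLaw_gaussianReal (hg t))

theorem integral_mul_pow_of_hasLaw {X : Ω → ℝ} {v : ℝ≥0} (h : HasLaw X (gaussianReal 0 v) P)
    (k : ℕ) : ∫ ω, (X ω : ℂ) ^ (k + 1) ∂P = v * (k * ∫ ω, (X ω : ℂ) ^ (k - 1) ∂P) := by
  have hm : ∀ j : ℕ, ∫ ω, (X ω : ℂ) ^ j ∂P = ((∫ x, x ^ j ∂(gaussianReal 0 v) : ℝ) : ℂ) := by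
    intro j
    rw [← h.map_eq, integral_map h.aemeasurable (by fun_prop), ← integral_complex_ofReal]
    simp
  rw [hm, hm]
  have := integral_mul_pow_gaussianReal v k
  simp only [pow_succ']
  rw [this]
  push_cast
  rfl

theorem integral_eval_monomial [Fintype ι] (hg : ∀ t, HasLaw (g t) (gaussianReal 0 (s t)) P)
    (hind : iIndepFun g P) (d : ι →₀ ℕ) (c : ℂ) :
    ∫ ω, MvPolynomial.eval (fun t => (g t ω : ℂ)) (MvPolynomial.monomial d c) ∂P =
      c * ∏ t, ∫ ω, (g t ω : ℂ) ^ d t ∂P := by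
  simp only [MvPolynomial.eval_monomial]
  rw [integral_const_mul]
  congr 1
  rw [← hind.integral_fun_prod_comp (f := fun t (x : ℝ) => (x : ℂ) ^ d t)
    (fun t => (hg t).aemeasurable) (fun t => by fun_prop)]
  congr 1
  ext ω
  rw [Finsupp.prod_fintype _ _ (by simp)]

/-- Gaussian integration by parts for polynomials in independent centered Gaussian variables. -/
theorem integral_eval_X_mul [Fintype ι] (hg : ∀ t, HasLaw (g t) (gaussianReal 0 (s t)) P)
    (hind : iIndepFun g P) (t : ι) (p : MvPolynomial ι ℂ) :
    ∫ ω, MvPolynomial.eval (fun t => (g t ω : ℂ)) (MvPolynomial.X t * p) ∂P =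
      s t * ∫ ω, MvPolynomial.eval (fun t => (g t ω : ℂ)) (MvPolynomial.pderiv t p) ∂P := by
  classical
  induction p using MvPolynomial.induction_on' with
  | monomial d c =>
    rw [MvPolynomial.X, MvPolynomial.monomial_mul, MvPolynomial.pderiv_monomial,
      integral_eval_monomial hg hind, integral_eval_monomial hg hind,
      ← Finset.mul_prod_erase _ _ (Finset.mem_univ t), ← Finset.mul_prod_erase _ _ (Finset.mem_univ t)]
    -- Only the exponent of the variable `t` differs between the two monomials, which leaves the
    -- one-variable identity.
    have h1 : ∏ u ∈ Finset.univ.erase t, ∫ ω, (g u ω : ℂ) ^ (Finsupp.single t 1 + d : ι →₀ ℕ) u ∂P =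
        ∏ u ∈ Finset.univ.erase t, ∫ ω, (g u ω : ℂ) ^ (d - Finsupp.single t 1 : ι →₀ ℕ) u ∂P := by
      refine Finset.prod_congr rfl fun u hu => ?_
      have : t ≠ u := (Finset.ne_of_mem_erase hu).symm
      simp [this]
    rw [h1]
    have h2 := integral_mul_pow_of_hasLaw (hg t) (d t)
    simp only [Finsupp.add_apply, Finsupp.tsub_apply, Finsupp.single_eq_same, add_comm 1]
    rw [h2]
    ring
  | add p q hp hq =>
    have hi : ∀ p : MvPolynomial ι ℂ, Integrable
        (fun ω => MvPolynomial.eval (fun t => (g t ω : ℂ)) p) P := fun p =>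
      (hasMoments_mvPolynomial_eval hg p).integrable
    simp only [mul_add, map_add]
    rw [integral_add (hi _) (hi _), integral_add (hi _) (hi _), hp, hq, mul_add]

end Polynomial

/-! ### Hermitian matrices -/

section Hermitian

variable {I : Type*} [Fintype I] [DecidableEq I]

theorem norm_apply_comm_of_isHermitian {B : Matrix I I ℂ} (hB : B.IsHermitian) (i j : I) :
    ‖B i j‖ = ‖B j i‖ := by
  rw [← hB.apply i j, norm_star]

theorem mul_self_diag_of_isHermitian {B : Matrix I I ℂ} (hB : B.IsHermitian) (i : I) :
    (B * B) i i = ((∑ j, ‖B j i‖ ^ 2 : ℝ) : ℂ) := by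
  rw [Matrix.mul_apply]
  push_cast
  refine Finset.sum_congr rfl fun j _ => ?_
  rw [← hB.apply i j, mul_comm]
  exact RCLike.mul_conj (K := ℂ) (B j i)

theorem norm_mul_self_diag_of_isHermitian {B : Matrix I I ℂ} (hB : B.IsHermitian) (i : I) :
    ‖(B * B) i i‖ = ∑ j, ‖B j i‖ ^ 2 := by
  rw [mul_self_diag_of_isHermitian hB, Complex.norm_real, Real.norm_of_nonneg]
  exact Finset.sum_nonneg fun j _ => by positivity

/-- The arithmetic–geometric mean inequality in place of Cauchy–Schwarz keeps the bound linear in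
diagonal entries of squares, so that expectations can be taken term by term. -/
theorem sum_norm_mul_norm_le_of_isHermitian {B C : Matrix I I ℂ} (hB : B.IsHermitian)
    (hC : C.IsHermitian) (i : I) :
    ∑ j, ‖B j i‖ * ‖C j i‖ ≤ ‖(B * B) i i‖ + ‖(C * C) i i‖ := by
  rw [norm_mul_self_diag_of_isHermitian hB, norm_mul_self_diag_of_isHermitian hC,
    ← Finset.sum_add_distrib]
  exact Finset.sum_le_sum fun j _ => by nlinarith [sq_nonneg (‖B j i‖ - ‖C j i‖)]

/-- Iterating `|B_ii|² ≤ (B²)_ii` trades a high power of a diagonal entry for a single diagonal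
entry of a higher matrix power. -/
theorem norm_diag_pow_le_of_isHermitian {H : Matrix I I ℂ} (hH : H.IsHermitian) (a r : ℕ) (i : I) :
    ‖(H ^ a) i i‖ ^ 2 ^ r ≤ ‖(H ^ (2 ^ r * a)) i i‖ := by
  induction r with
  | zero => simp
  | succ r ih =>
    calc ‖(H ^ a) i i‖ ^ 2 ^ (r + 1) = (‖(H ^ a) i i‖ ^ 2 ^ r) ^ 2 := by rw [← pow_mul, pow_succ]
      _ ≤ ‖(H ^ (2 ^ r * a)) i i‖ ^ 2 := by gcongr
      _ ≤ ∑ j, ‖(H ^ (2 ^ r * a)) j i‖ ^ 2 :=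
        Finset.single_le_sum (f := fun j => ‖(H ^ (2 ^ r * a)) j i‖ ^ 2)
          (fun j _ => by positivity) (Finset.mem_univ i)
      _ = ‖(H ^ (2 ^ (r + 1) * a)) i i‖ := by
        rw [← norm_mul_self_diag_of_isHermitian (hH.pow _), ← pow_add,
          show 2 ^ (r + 1) * a = 2 ^ r * a + 2 ^ r * a by ring]

end Hermitian

/-! ### Integration by parts for powers of a matrix. -/

/-- A random Hermitian matrix `A` whose entries belong to an algebra `R` of random variables, with
diagonal mean `mean`, such that expectations satisfy the Gaussian integration by parts formula with
`v i j = E |A i j - E A i j| ^ 2` and `w i j = E (A i j - E A i j) ^ 2` off the diagonal. -/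
structure WickMatrix {Ω : Type*} [MeasurableSpace Ω] (P : Measure Ω) (I : Type*) [Fintype I]
    [DecidableEq I] (R : Type*) [CommRing R] [Algebra ℂ R] where
  ev : Ω → R →ₐ[ℂ] ℂ
  moments : ∀ p, HasMoments P fun ω => ev ω p
  A : Matrix I I R
  mean : I → ℝ
  v : I → I → ℝ
  w : I → I → ℝ
  w_le : ∀ i j, |w i j| ≤ v i j
  herm : ∀ ω i j, star (ev ω (A i j)) = ev ω (A j i)
  der : I → I → Derivation ℂ R R
  -- For `i = j` both indicators are active at `k = l = i`, so the variance of a diagonal entry is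
  -- `v i i + w i i`.
  der_A : ∀ i j k l, der i j (A k l) = algebraMap ℂ R
    (((if k = j ∧ l = i then v i j else 0) + (if k = i ∧ l = j then w i j else 0) : ℝ) : ℂ)
  ibp : ∀ i j p, ∫ ω, ev ω (A i j * p) ∂P =
    (if i = j then (mean i : ℂ) else 0) * ∫ ω, ev ω p ∂P + ∫ ω, ev ω (der i j p) ∂P

namespace WickMatrix

variable {Ω : Type*} [MeasurableSpace Ω] {P : Measure Ω} {I : Type*} [Fintype I] [DecidableEq I]
  {R : Type*} [CommRing R] [Algebra ℂ R] (W : WickMatrix P I R)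

/-- The expectation. -/
noncomputable def E (p : R) : ℂ := ∫ ω, W.ev ω p ∂P

theorem integrable (p : R) : Integrable (fun ω => W.ev ω p) P := (W.moments p).integrable

theorem E_add (p q : R) : W.E (p + q) = W.E p + W.E q := by
  simp only [E, map_add]
  exact integral_add (W.integrable p) (W.integrable q)

theorem E_sum {κ : Type*} (s : Finset κ) (f : κ → R) : W.E (∑ k ∈ s, f k) = ∑ k ∈ s, W.E (f k) := by
  simp only [E, map_sum]
  exact integral_finsetSum _ fun k _ => W.integrable (f k)

theorem E_algebraMap_mul (c : ℂ) (p : R) : W.E (algebraMap ℂ R c * p) = c * W.E p := by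
  simp only [E, map_mul, AlgHom.commutes, Algebra.algebraMap_self, RingHom.id_apply]
  exact integral_const_mul _ _

/-- The realization of the random matrix. -/
def mat (ω : Ω) : Matrix I I ℂ := W.A.map (W.ev ω)

theorem ev_pow_apply (ω : Ω) (k : ℕ) (i j : I) : W.ev ω ((W.A ^ k) i j) = (W.mat ω ^ k) i j := by
  have : (W.A ^ k).map (W.ev ω) = W.mat ω ^ k :=
    map_pow (RingHom.mapMatrix (m := I) (W.ev ω : R →+* ℂ)) W.A k
  rw [← this, Matrix.map_apply]

theorem isHermitian_mat (ω : Ω) : (W.mat ω).IsHermitian := by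
  ext i j
  simp only [Matrix.conjTranspose_apply, mat, Matrix.map_apply]
  exact W.herm ω j i

theorem v_nonneg (i j : I) : 0 ≤ W.v i j := (abs_nonneg _).trans (W.w_le i j)

/-- Leibniz' rule, where the derivative of `A` is `v` times the matrix unit at `(j, i)` plus `w`
times the one at `(i, j)`. -/
theorem der_pow (i j : I) (k : ℕ) (x y : I) : W.der i j ((W.A ^ k) x y) =
    ∑ a ∈ Finset.range k,
      (algebraMap ℂ R (W.v i j) * ((W.A ^ a) x j * (W.A ^ (k - 1 - a)) i y) +
        algebraMap ℂ R (W.w i j) * ((W.A ^ a) x i * (W.A ^ (k - 1 - a)) j y)) := by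
  induction k generalizing y with
  | zero =>
    by_cases h : x = y <;> simp [Matrix.one_apply, h]
  | succ k ih =>
    rw [pow_succ, Matrix.mul_apply, map_sum]
    simp only [Derivation.leibniz, smul_eq_mul, W.der_A, ih]
    rw [Finset.sum_add_distrib, Finset.sum_range_succ, add_comm]
    congr 1
    · simp only [Finset.mul_sum]
      rw [Finset.sum_comm]
      refine Finset.sum_congr rfl fun a ha => ?_
      have hk : k + 1 - 1 - a = (k - 1 - a) + 1 := by
        have := Finset.mem_range.1 ha; omega
      rw [hk, pow_succ, Matrix.mul_apply, Matrix.mul_apply]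
      simp only [Finset.mul_sum]
      rw [← Finset.sum_add_distrib]
      exact Finset.sum_congr rfl fun z _ => by ring
    · have : k + 1 - 1 - k = 0 := by omega
      rw [this, pow_zero]
      simp only [Complex.ofReal_add, map_add, mul_add, Finset.sum_add_distrib]
      congr 1
      · rw [Finset.sum_eq_single j]
        · by_cases h : y = i
          · simp [h, Matrix.one_apply]; ring
          · simp [h, Ne.symm h]
        · intro z _ hz; simp [hz]
        · simp
      · rw [Finset.sum_eq_single i]
        · by_cases h : y = j
          · simp [h, Matrix.one_apply]; ring
          · simp [h, Ne.symm h]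
        · intro z _ hz; simp [hz]
        · simp

/-- By cyclicity of the trace the `k` Leibniz terms coincide. -/
theorem der_trace_pow (i j : I) (k : ℕ) : W.der i j (W.A ^ k).trace =
    k * (algebraMap ℂ R (W.v i j) * (W.A ^ (k - 1)) i j +
      algebraMap ℂ R (W.w i j) * (W.A ^ (k - 1)) j i) := by
  have hmul : ∀ a ∈ Finset.range k, ∀ x y : I,
      ∑ z, (W.A ^ a) z y * (W.A ^ (k - 1 - a)) x z = (W.A ^ (k - 1)) x y := by
    intro a ha x y
    have hk : k - 1 = (k - 1 - a) + a := by
      have := Finset.mem_range.1 ha; omega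
    rw [show W.A ^ (k - 1) = W.A ^ (k - 1 - a) * W.A ^ a by rw [← pow_add, ← hk], Matrix.mul_apply]
    exact Finset.sum_congr rfl fun z _ => mul_comm _ _
  rw [Matrix.trace, map_sum]
  simp only [Matrix.diag_apply, W.der_pow]
  rw [Finset.sum_comm]
  have : ∀ a ∈ Finset.range k, ∑ x,
      (algebraMap ℂ R (W.v i j) * ((W.A ^ a) x j * (W.A ^ (k - 1 - a)) i x) +
        algebraMap ℂ R (W.w i j) * ((W.A ^ a) x i * (W.A ^ (k - 1 - a)) j x)) =
      algebraMap ℂ R (W.v i j) * (W.A ^ (k - 1)) i j +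
        algebraMap ℂ R (W.w i j) * (W.A ^ (k - 1)) j i := fun a ha => by
    rw [Finset.sum_add_distrib, ← Finset.mul_sum, ← Finset.mul_sum, hmul a ha, hmul a ha]
  rw [Finset.sum_congr rfl this, Finset.sum_const, Finset.card_range, nsmul_eq_mul]

/-- The Schwinger–Dyson equation. -/
theorem E_pow_succ_mul (i : I) (k : ℕ) (Q : R) :
    W.E ((W.A ^ (k + 1)) i i * Q) = W.mean i * W.E ((W.A ^ k) i i * Q) +
      (∑ a ∈ Finset.range k,
        (∑ j, (W.v i j : ℂ) * W.E ((W.A ^ a) j j * ((W.A ^ (k - 1 - a)) i i * Q)) +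
        ∑ j, (W.w i j : ℂ) * W.E ((W.A ^ a) j i * (W.A ^ (k - 1 - a)) j i * Q)) +
      ∑ j, W.E ((W.A ^ k) j i * W.der i j Q)) := by
  -- Integration by parts is applied to the first entry `A i j` of the product, for each `j`. The
  -- `v`-terms split off diagonal entries at `j` and at `i`; the `w`-terms and the derivative of `Q`
  -- pair entries at `(j, i)`.
  rw [pow_succ', Matrix.mul_apply, Finset.sum_mul, W.E_sum]
  have h1 : ∀ j, W.E (W.A i j * (W.A ^ k) j i * Q) =
      (if i = j then (W.mean i : ℂ) else 0) * W.E ((W.A ^ k) j i * Q) +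
        W.E (W.der i j ((W.A ^ k) j i * Q)) := fun j => by
    rw [mul_assoc]; exact W.ibp i j _
  simp only [h1, Finset.sum_add_distrib, ite_mul, zero_mul, Finset.sum_ite_eq, Finset.mem_univ,
    if_true]
  congr 1
  have h2 : ∀ j, W.der i j ((W.A ^ k) j i * Q) =
      (∑ a ∈ Finset.range k,
        (algebraMap ℂ R (W.v i j) * ((W.A ^ a) j j * ((W.A ^ (k - 1 - a)) i i * Q)) +
          algebraMap ℂ R (W.w i j) * ((W.A ^ a) j i * (W.A ^ (k - 1 - a)) j i * Q))) +
        (W.A ^ k) j i * W.der i j Q := fun j => by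
    rw [Derivation.leibniz, W.der_pow, smul_eq_mul, smul_eq_mul, Finset.mul_sum, add_comm]
    congr 1
    exact Finset.sum_congr rfl fun a _ => by ring
  simp only [h2, W.E_add, W.E_sum, W.E_algebraMap_mul, Finset.sum_add_distrib]
  congr 2 <;> rw [Finset.sum_comm]

end WickMatrix

/-! ### The algebra of random variables of a block Gaussian matrix -/

section Construction

open MvPolynomial

/-- The unordered pairs of indices, represented by ordered ones. -/
abbrev UpperPair (n : ℕ) : Type := {q : Fin n × Fin n // q.1 ≤ q.2}

/-- The unordered pair of two indices. -/
def upperPair {n : ℕ} (i j : Fin n) : UpperPair n := ⟨(min i j, max i j), min_le_max⟩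

theorem upperPair_comm {n : ℕ} (i j : Fin n) : upperPair i j = upperPair j i := by
  simp [upperPair, min_comm, max_comm]

theorem upperPair_of_le {n : ℕ} {i j : Fin n} (h : i ≤ j) : upperPair i j = ⟨(i, j), h⟩ := by
  simp [upperPair, h]

theorem upperPair_eq_iff {n : ℕ} {i j k l : Fin n} :
    upperPair k l = upperPair i j ↔ (k = j ∧ l = i) ∨ (k = i ∧ l = j) := by
  simp only [upperPair, Subtype.mk.injEq, Prod.mk.injEq]
  grind

/-- The coefficient of the imaginary part in the entry of a Hermitian matrix. -/
noncomputable def imCoeff {n : ℕ} (i j : Fin n) : ℂ :=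
  if i < j then Complex.I else if j < i then -Complex.I else 0

theorem imCoeff_swap {n : ℕ} (i j : Fin n) : imCoeff j i = star (imCoeff i j) := by
  unfold imCoeff
  rcases lt_trichotomy i j with h | h | h
  · simp [h, h.not_gt]
  · simp [h]
  · simp [h, h.not_gt]

theorem imCoeff_self {n : ℕ} (i : Fin n) : imCoeff i i = 0 := by simp [imCoeff]

theorem imCoeff_mul_self {n : ℕ} {i j : Fin n} (h : i ≠ j) : imCoeff i j * imCoeff i j = -1 := by
  rcases h.lt_or_gt with h | h <;> simp [imCoeff, h, h.not_gt]

theorem imCoeff_mul_swap {n : ℕ} {i j : Fin n} (h : i ≠ j) : imCoeff i j * imCoeff j i = 1 := by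
  rcases h.lt_or_gt with h | h <;> simp [imCoeff, h, h.not_gt]

variable {n : ℕ}

/-- The generic Hermitian matrix with polynomial entries. -/
noncomputable def genericHermitian (n : ℕ) :
    Matrix (Fin n) (Fin n) (MvPolynomial (UpperPair n ⊕ UpperPair n) ℂ) :=
  fun i j => X (.inl (upperPair i j)) + C (imCoeff i j) * X (.inr (upperPair i j))

/-- The derivation that corresponds to integration by parts with respect to an entry of
the generic Hermitian matrix. -/
noncomputable def genericDer (s t : UpperPair n → ℝ) (i j : Fin n) :
    Derivation ℂ (MvPolynomial (UpperPair n ⊕ UpperPair n) ℂ)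
      (MvPolynomial (UpperPair n ⊕ UpperPair n) ℂ) :=
  (s (upperPair i j) : ℂ) • pderiv (.inl (upperPair i j)) +
    (imCoeff i j * (t (upperPair i j) : ℂ)) • pderiv (.inr (upperPair i j))

/-- The product of the two `imCoeff` is `1` for transposed off-diagonal entries and `-1` for equal
ones, so the coefficient becomes `s + t = E|Y i j|²` or `s - t = E (Y i j)²`, the intended `v` and
`w`. -/
theorem genericDer_apply (s t : UpperPair n → ℝ) (i j k l : Fin n) :
    genericDer s t i j (genericHermitian n k l) =
      if upperPair k l = upperPair i j then
        C ((s (upperPair i j) : ℂ) + imCoeff i j * imCoeff k l * t (upperPair i j)) else 0 := by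
  simp only [genericDer, genericHermitian, Derivation.add_apply, Derivation.smul_apply, map_add,
    pderiv_C_mul]
  split_ifs with h
  · rw [h]
    simp [smul_eq_C_mul]
    ring
  · rw [pderiv_X_of_ne fun h' => h (Sum.inl.inj h'), pderiv_X_of_ne fun h' => h (Sum.inr.inj h'),
      pderiv_X_of_ne (by simp), pderiv_X_of_ne (by simp)]
    simp

variable {Ω : Type*} [MeasurableSpace Ω] {P : Measure Ω} [IsProbabilityMeasure P]

theorem integral_sq_of_hasLaw {X : Ω → ℝ} {v : ℝ≥0} (h : HasLaw X (gaussianReal 0 v) P) :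
    ∫ ω, X ω ^ 2 ∂P = v := by
  have h1 := integral_mul_pow_gaussianReal v 1
  have h2 : ∫ ω, X ω ^ 2 ∂P = ∫ x, x ^ 2 ∂(gaussianReal 0 v) := by
    rw [← h.map_eq, integral_map h.aemeasurable (by fun_prop)]
  rw [h2]
  simpa [← sq] using h1

theorem integrable_sq_of_hasLaw {X : Ω → ℝ} {v : ℝ≥0} (h : HasLaw X (gaussianReal 0 v) P) :
    Integrable (fun ω => X ω ^ 2) P := by
  have := integrable_pow_gaussianReal v 2
  rw [← h.map_eq, integrable_map_measure (by fun_prop) h.aemeasurable] at this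
  exact this

/-- A block Gaussian matrix, shifted by a diagonal matrix, is realized by a matrix satisfying the
integration by parts formula. -/
theorem exists_wickMatrix {blk : Fin n → Fin 2} {V : Matrix (Fin 2) (Fin 2) ℝ}
    {Y : Ω → Matrix (Fin n) (Fin n) ℂ} (hY : IsBlockGaussian P blk V Y) (d : Fin n → ℝ) :
    ∃ W : WickMatrix P (Fin n) (MvPolynomial (UpperPair n ⊕ UpperPair n) ℂ),
      W.mean = d ∧ (∀ i j, W.v i j = V (blk i) (blk j) / n) ∧
      ∀ᵐ ω ∂P, W.mat ω = Y ω + Matrix.diagonal fun i => (d i : ℂ) := by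
  choose s hs using fun q : UpperPair n => hY.gaussian_re q.1.1 q.1.2 q.2
  choose t ht using fun q : UpperPair n => hY.gaussian_im q.1.1 q.1.2 q.2
  let g : UpperPair n ⊕ UpperPair n → Ω → ℝ := Sum.elim
    (fun q ω => (Y ω q.1.1 q.1.2).re) (fun q ω => (Y ω q.1.1 q.1.2).im)
  let st : UpperPair n ⊕ UpperPair n → ℝ≥0 := Sum.elim s t
  have hg : ∀ q, HasLaw (g q) (gaussianReal 0 (st q)) P := by
    rintro (q | q)
    · exact hs q
    · exact ht q
  have hind : iIndepFun g P := hY.indep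
  have hvar : ∀ i j, i ≠ j →
      V (blk i) (blk j) / n = s (upperPair i j) + t (upperPair i j) := by
    have hle : ∀ i j, i ≤ j → ∫ ω, ‖Y ω i j‖ ^ 2 ∂P =
        s (upperPair i j) + t (upperPair i j) := fun i j hij => by
      rw [upperPair_of_le hij, ← integral_sq_of_hasLaw (hs _), ← integral_sq_of_hasLaw (ht _),
        ← integral_add (integrable_sq_of_hasLaw (hs _)) (integrable_sq_of_hasLaw (ht _))]
      refine integral_congr_ae (ae_of_all _ fun ω => ?_)
      simp only [Complex.sq_norm, Complex.normSq_apply]; ring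
    intro i j hij
    rw [← hY.variance i j]
    rcases le_total i j with h | h
    · exact hle i j h
    · rw [upperPair_comm, ← hle j i h]
      refine integral_congr_ae ?_
      filter_upwards [hY.hermitian] with ω hω
      rw [norm_apply_comm_of_isHermitian hω]
  have hdiag : ∀ i, ∀ᵐ ω ∂P, (Y ω i i).im = 0 := fun i => by
    filter_upwards [hY.hermitian] with ω hω
    exact Complex.conj_eq_iff_im.1 (hω.apply i i)
  have hvar' : ∀ i, V (blk i) (blk i) / n = s (upperPair i i) := fun i => by
    rw [← hY.variance i i, upperPair_of_le le_rfl, ← integral_sq_of_hasLaw (hs _)]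
    refine integral_congr_ae ?_
    filter_upwards [hdiag i] with ω hω
    simp only [Complex.sq_norm, Complex.normSq_apply, hω]; ring
  -- Only upper triangular entries are evaluated, so the realized matrix is Hermitian for every `ω`;
  -- it agrees with the given one almost surely.
  let ev : Ω → MvPolynomial (UpperPair n ⊕ UpperPair n) ℂ →ₐ[ℂ] ℂ :=
    fun ω => MvPolynomial.aeval fun q => (g q ω : ℂ)
  have hev : ∀ ω p, ev ω p = MvPolynomial.eval (fun q => (g q ω : ℂ)) p := fun ω p => by
    rw [← MvPolynomial.coe_aeval_eq_eval]; rfl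
  have hevY : ∀ ω i j, ev ω (genericHermitian n i j) =
      (g (.inl (upperPair i j)) ω : ℂ) + imCoeff i j * g (.inr (upperPair i j)) ω := fun ω i j => by
    rw [hev]; simp [genericHermitian]
  have hmom : ∀ p, HasMoments P fun ω => ev ω p := fun p => by
    simp only [hev]
    exact hasMoments_mvPolynomial_eval hg p
  refine ⟨{
    ev := ev
    moments := hmom
    A := genericHermitian n + Matrix.diagonal fun i => C (d i : ℂ)
    mean := d
    v := fun i j => V (blk i) (blk j) / n
    -- On the diagonal `v` alone carries the variance, so `w` has to vanish there.
    w := fun i j => if i = j then 0 else s (upperPair i j) - t (upperPair i j)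
    w_le := ?_
    herm := ?_
    der := genericDer (fun q => s q) (fun q => t q)
    der_A := ?_
    ibp := ?_ }, rfl, fun _ _ => rfl, ?_⟩
  · intro i j
    have h1 := (s (upperPair i j)).2
    have h2 := (t (upperPair i j)).2
    simp only [NNReal.val_eq_coe] at h1 h2
    by_cases h : i = j
    · subst h
      rw [if_pos rfl, hvar', abs_zero]; exact h1
    · rw [if_neg h, hvar i j h, abs_le]
      constructor <;> linarith
  · intro ω i j
    rw [Matrix.add_apply, Matrix.add_apply, map_add, map_add, hevY, hevY, star_add, star_add,
      star_mul, upperPair_comm j i, imCoeff_swap i j]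
    congr 1
    · simp [mul_comm]
    · by_cases h : i = j
      · subst h; simp [hev]
      · simp [Matrix.diagonal_apply_ne _ h, Matrix.diagonal_apply_ne _ (Ne.symm h)]
  · intro i j k l
    have hd0 : genericDer (fun q => (s q : ℝ)) (fun q => (t q : ℝ)) i j
        (Matrix.diagonal (fun i => C (d i : ℂ)) k l) = 0 := by
      by_cases h : k = l
      · subst h
        rw [Matrix.diagonal_apply_eq]
        exact Derivation.map_algebraMap _ _
      · rw [Matrix.diagonal_apply_ne _ h, map_zero]
    rw [Matrix.add_apply, map_add, hd0, add_zero, genericDer_apply, MvPolynomial.algebraMap_eq]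
    by_cases h1 : k = j ∧ l = i
    · obtain ⟨rfl, rfl⟩ := h1
      rw [if_pos (upperPair_comm _ _), if_pos ⟨rfl, rfl⟩]
      congr 1
      by_cases h : l = k
      · subst h
        simp [imCoeff_self, hvar']
      · rw [imCoeff_mul_swap h, hvar _ _ h, if_neg fun h' => h h'.2]
        push_cast; ring
    · by_cases h2 : k = i ∧ l = j
      · obtain ⟨rfl, rfl⟩ := h2
        have h : k ≠ l := fun h => h1 ⟨h, h.symm⟩
        rw [if_pos rfl, if_neg h1, if_pos ⟨rfl, rfl⟩, if_neg h, imCoeff_mul_self h]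
        congr 1; push_cast; ring
      · rw [if_neg (by rw [upperPair_eq_iff]; tauto), if_neg h1, if_neg h2]
        simp
  · intro i j p
    have hint : ∀ p, Integrable (fun ω => ev ω p) P := fun p => (hmom p).integrable
    have hX : ∀ q p, ∫ ω, ev ω (X q * p) ∂P = st q * ∫ ω, ev ω (pderiv q p) ∂P := fun q p => by
      simp only [hev]; exact integral_eval_X_mul hg hind q p
    have hC : ∀ c p, ∫ ω, ev ω (C c * p) ∂P = c * ∫ ω, ev ω p ∂P := fun c p => by
      rw [← integral_const_mul]; simp [hev]
    have hadd : ∀ p q, ∫ ω, ev ω (p + q) ∂P = ∫ ω, ev ω p ∂P + ∫ ω, ev ω q ∂P := fun p q => by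
      rw [← integral_add (hint p) (hint q)]; simp only [map_add]
    have hD : (Matrix.diagonal (fun i => C (d i : ℂ)) : Matrix (Fin n) (Fin n)
        (MvPolynomial (UpperPair n ⊕ UpperPair n) ℂ)) i j = C (if i = j then (d i : ℂ) else 0) := by
      rw [Matrix.diagonal_apply]; split_ifs <;> simp
    rw [Matrix.add_apply, add_mul, hadd, hD, hC, add_comm]
    congr 1
    simp only [genericDer, genericHermitian, Derivation.add_apply, Derivation.smul_apply,
      smul_eq_C_mul]
    rw [add_mul, hadd, hadd, hX, mul_assoc, hC, hX, hC, hC]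
    simp only [st, Sum.elim_inl, Sum.elim_inr]
    ring
  · filter_upwards [hY.hermitian, ae_all_iff.2 hdiag] with ω hω hω'
    ext i j
    change ev ω ((genericHermitian n + Matrix.diagonal (fun i => C (d i : ℂ)) :
      Matrix (Fin n) (Fin n) (MvPolynomial (UpperPair n ⊕ UpperPair n) ℂ)) i j) = _
    rw [Matrix.add_apply, map_add, hevY, Matrix.add_apply]
    congr 1
    · simp only [g, Sum.elim_inl, Sum.elim_inr]
      rcases lt_trichotomy i j with h | h | h
      · rw [upperPair_of_le h.le]
        simp only [imCoeff, if_pos h]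
        rw [mul_comm]; exact Complex.re_add_im _
      · subst h
        rw [upperPair_of_le le_rfl, imCoeff_self, zero_mul, add_zero]
        exact Complex.conj_eq_iff_re.1 (hω.apply i i)
      · rw [upperPair_comm, upperPair_of_le h.le, ← hω.apply i j]
        simp only [imCoeff, if_pos h, if_neg h.not_gt]
        apply Complex.ext <;> simp
    · by_cases h : i = j
      · subst h; simp [hev]
      · simp [Matrix.diagonal_apply_ne _ h]

end Construction

/-! ### Paths -/

section Paths

theorem matrix_pow_apply_eq_sum {I R : Type*} [Fintype I] [DecidableEq I] [CommRing R]
    (A : Matrix I I R) (k : ℕ) (i j : I) :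
    (A ^ k) i j = ∑ g : Fin k → I,
      if (Fin.cons i g : Fin (k + 1) → I) (Fin.last k) = j then
        ∏ l : Fin k, A ((Fin.cons i g : Fin (k + 1) → I) l.castSucc)
          ((Fin.cons i g : Fin (k + 1) → I) l.succ) else 0 := by
  induction k generalizing i with
  | zero => simp [Matrix.one_apply]
  | succ k ih =>
    rw [pow_succ', Matrix.mul_apply,
      ← (Fin.consEquiv (fun _ : Fin (k + 1) => I)).sum_comp, Fintype.sum_prod_type]
    refine Finset.sum_congr rfl fun z _ => ?_
    rw [ih, Finset.mul_sum]
    refine Finset.sum_congr rfl fun g _ => ?_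
    rw [Fin.prod_univ_succ, ← Fin.succ_last]
    simp only [Fin.consEquiv_apply, Fin.cons_succ, Fin.castSucc_zero, Fin.cons_zero,
      ← Fin.succ_castSucc, mul_ite, mul_zero]

variable {I : Type*} [DecidableEq I]

/-- The edges of a path that are not loops. -/
def pathEdges {k : ℕ} (F : Fin (k + 1) → I) : Finset (Sym2 I) :=
  (Finset.univ.filter fun l : Fin k => F l.castSucc ≠ F l.succ).image
    fun l => s(F l.castSucc, F l.succ)

/-- Induction by removing the starting point: if it is not visited later, its first step is a
non-loop edge that is not used later either. -/
theorem card_image_le_card_pathEdges {k : ℕ} (F : Fin (k + 1) → I) :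
    (Finset.univ.image F).card ≤ (pathEdges F).card + 1 := by
  induction k with
  | zero =>
    refine (Finset.card_image_le).trans ?_
    simp
  | succ k ih =>
    have hV : Finset.univ.image F = insert (F 0) (Finset.univ.image (Fin.tail F)) := by
      ext x
      simp only [Finset.mem_image, Finset.mem_univ, true_and, Finset.mem_insert, Fin.tail,
        Fin.exists_fin_succ]
      tauto
    have hsub : pathEdges (Fin.tail F) ⊆ pathEdges F := by
      intro e he
      simp only [pathEdges, Finset.mem_image, Finset.mem_filter, Finset.mem_univ, true_and] at he ⊢
      obtain ⟨l, hl, rfl⟩ := he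
      exact ⟨l.succ, by simpa [Fin.tail] using hl, by simp [Fin.tail]⟩
    by_cases h : F 0 ∈ Finset.univ.image (Fin.tail F)
    · rw [hV, Finset.insert_eq_of_mem h]
      exact (ih _).trans (Nat.add_le_add_right (Finset.card_le_card hsub) 1)
    · have h01 : F 0 ≠ F 1 := fun h' => h (by
        rw [h']; exact Finset.mem_image.2 ⟨0, Finset.mem_univ _, rfl⟩)
      have hmem : s(F 0, F 1) ∈ pathEdges F := by
        simp only [pathEdges, Finset.mem_image, Finset.mem_filter, Finset.mem_univ, true_and]
        exact ⟨0, by simpa using h01, by simp⟩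
      have hnot : s(F 0, F 1) ∉ pathEdges (Fin.tail F) := by
        intro he
        simp only [pathEdges, Finset.mem_image, Finset.mem_filter, Finset.mem_univ, true_and] at he
        obtain ⟨l, _, hl⟩ := he
        rw [Sym2.eq_iff] at hl
        rcases hl with ⟨h1, _⟩ | ⟨_, h1⟩
        · exact h (Finset.mem_image.2 ⟨_, Finset.mem_univ _, h1⟩)
        · exact h (Finset.mem_image.2 ⟨_, Finset.mem_univ _, h1⟩)
      rw [hV, Finset.card_insert_of_notMem h]
      have h2 : (insert s(F 0, F 1) (pathEdges (Fin.tail F))).card ≤ (pathEdges F).card :=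
        Finset.card_le_card (Finset.insert_subset hmem hsub)
      rw [Finset.card_insert_of_notMem hnot] at h2
      have := ih (Fin.tail F)
      omega

theorem two_mul_card_pathEdges_le {k : ℕ} (F : Fin (k + 1) → I)
    (h : ∀ l₀ : Fin k, F l₀.castSucc ≠ F l₀.succ →
      ∃ l ≠ l₀, s(F l.castSucc, F l.succ) = s(F l₀.castSucc, F l₀.succ)) :
    2 * (pathEdges F).card ≤
      (Finset.univ.filter fun l : Fin k => F l.castSucc ≠ F l.succ).card := by
  rw [pathEdges, mul_comm]
  rw [mul_comm]
  refine Finset.mul_card_image_le_card _ _ fun e he => ?_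
  obtain ⟨l₀, hl₀, rfl⟩ := Finset.mem_image.1 he
  have hne := (Finset.mem_filter.1 hl₀).2
  obtain ⟨l, hl, hs⟩ := h l₀ hne
  have hlne : F l.castSucc ≠ F l.succ := fun h' => by
    rw [h', Sym2.eq_iff] at hs
    rcases hs with ⟨h1, h2⟩ | ⟨h1, h2⟩
    · exact hne (h1.symm.trans h2)
    · exact hne (h2.symm.trans h1)
  refine Finset.one_lt_card.2 ⟨l, ?_, l₀, ?_, hl⟩
  · simp only [Finset.mem_filter, Finset.mem_univ, true_and]
    exact ⟨hlne, hs⟩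
  · simp only [Finset.mem_filter, Finset.mem_univ, true_and]
    exact ⟨hne, trivial⟩

/-- Each step either stays in the set of visited points, with at most as many choices as visited
points, or enters a new point, where the at most `card I` choices are paid for by a factor `x`. The
set `s` holds the points already visited. -/
theorem sum_pow_card_union_image_le [Fintype I] {x : ℝ} (hx0 : 0 ≤ x)
    (hx : (Fintype.card I : ℝ) * x ≤ 1) (k : ℕ) (s : Finset I) :
    ∑ g : Fin k → I, x ^ (s ∪ Finset.univ.image g).card ≤ ((s.card : ℝ) + k + 1) ^ k * x ^ s.card := by
  induction k generalizing s with
  | zero => simp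
  | succ k ih =>
    have h1 : ∀ z : I, ∑ g : Fin k → I,
        x ^ (s ∪ Finset.univ.image (Fin.cons z g : Fin (k + 1) → I)).card ≤
        ((s.card : ℝ) + (k + 1 : ℕ) + 1) ^ k * x ^ (insert z s).card := fun z => by
      have e : ∀ g : Fin k → I, s ∪ Finset.univ.image (Fin.cons z g : Fin (k + 1) → I) =
          insert z s ∪ Finset.univ.image g := fun g => by
        ext y
        simp only [Finset.mem_union, Finset.mem_image, Finset.mem_univ, true_and,
          Fin.exists_fin_succ, Fin.cons_zero, Fin.cons_succ, Finset.mem_insert]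
        tauto
      simp only [e]
      refine (ih _).trans ?_
      have : ((insert z s).card : ℝ) ≤ s.card + 1 := by exact_mod_cast Finset.card_insert_le z s
      refine mul_le_mul_of_nonneg_right (pow_le_pow_left₀ (by positivity) ?_ _) (by positivity)
      push_cast
      linarith
    rw [← (Fin.consEquiv (fun _ : Fin (k + 1) => I)).sum_comp, Fintype.sum_prod_type]
    refine (Finset.sum_le_sum fun z _ => h1 z).trans ?_
    rw [← Finset.mul_sum]
    have h2 : ∑ z, x ^ (insert z s).card ≤ ((s.card : ℝ) + 1) * x ^ s.card := by
      have hz : ∀ z, x ^ (insert z s).card ≤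
          (if z ∈ s then x ^ s.card else 0) + x * x ^ s.card := fun z => by
        by_cases h : z ∈ s
        · rw [Finset.insert_eq_of_mem h, if_pos h]
          have : 0 ≤ x * x ^ s.card := by positivity
          linarith
        · rw [Finset.card_insert_of_notMem h, if_neg h, pow_succ']
          simp
      refine (Finset.sum_le_sum fun z _ => hz z).trans ?_
      rw [Finset.sum_add_distrib, Finset.sum_ite_mem, Finset.univ_inter, Finset.sum_const,
        Finset.sum_const, nsmul_eq_mul, nsmul_eq_mul, Finset.card_univ]
      have : 0 ≤ x ^ s.card := by positivity
      nlinarith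
    calc _ ≤ ((s.card : ℝ) + (k + 1 : ℕ) + 1) ^ k * (((s.card : ℝ) + 1) * x ^ s.card) := by gcongr
      _ ≤ ((s.card : ℝ) + (k + 1 : ℕ) + 1) ^ k *
          (((s.card : ℝ) + (k + 1 : ℕ) + 1) * x ^ s.card) := by
        gcongr
        push_cast
        linarith [(Nat.cast_nonneg k : (0 : ℝ) ≤ k)]
      _ = _ := by rw [pow_succ]; ring

/-- A substitute for Hölder's inequality: with `y` the largest factor, the product is at most `y ^ k
≤ 1 + y ^ (2 * k)`. Only even moments of single factors remain. -/
theorem prod_le_one_add_sum_pow {k : ℕ} {x : Fin k → ℝ} (hx : ∀ l, 0 ≤ x l) :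
    ∏ l, x l ≤ 1 + ∑ l, x l ^ (2 * k) := by
  rcases k with _ | k
  · simp
  · obtain ⟨l₀, _, hl₀⟩ := Finset.exists_max_image Finset.univ x Finset.univ_nonempty
    have h1 : ∏ l, x l ≤ x l₀ ^ (k + 1) := by
      refine (Finset.prod_le_prod (fun l _ => hx l) hl₀).trans ?_
      simp
    have h2 : x l₀ ^ (2 * (k + 1)) ≤ ∑ l, x l ^ (2 * (k + 1)) :=
      Finset.single_le_sum (f := fun l => x l ^ (2 * (k + 1)))
        (fun l _ => pow_nonneg (hx l) _) (Finset.mem_univ l₀)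
    have h3 : x l₀ ^ (k + 1) ≤ 1 + x l₀ ^ (2 * (k + 1)) := by
      rw [mul_comm, pow_mul]
      nlinarith [sq_nonneg (x l₀ ^ (k + 1) - 1)]
    linarith

end Paths

/-! ### Moment bounds independent of the matrix size. -/

namespace WickMatrix

variable {Ω : Type*} [MeasurableSpace Ω] {P : Measure Ω} {I : Type*} [Fintype I] [DecidableEq I]
  {R : Type*} [CommRing R] [Algebra ℂ R] (W : WickMatrix P I R)

theorem norm_E_le (p : R) : ‖W.E p‖ ≤ ∫ ω, ‖W.ev ω p‖ ∂P := norm_integral_le_integral_norm _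

theorem der_prod_eq_zero {κ : Type*} (s : Finset κ) (f : κ → R) (i j : I)
    (h : ∀ k ∈ s, W.der i j (f k) = 0) : W.der i j (∏ k ∈ s, f k) = 0 := by
  refine Finset.prod_induction f (fun p => W.der i j p = 0) (fun p q hp hq => ?_) (by simp) h
  simp [Derivation.leibniz, hp, hq]

/-- Integration by parts in the entry of the isolated step: the entry is off the diagonal, hence
centered, and its derivation kills the entries on all other edges. -/
theorem E_prod_path_eq_zero {k : ℕ} (F : Fin (k + 1) → I) (l₀ : Fin k)
    (hne : F l₀.castSucc ≠ F l₀.succ)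
    (h : ∀ l ≠ l₀, s(F l.castSucc, F l.succ) ≠ s(F l₀.castSucc, F l₀.succ)) :
    W.E (∏ l : Fin k, W.A (F l.castSucc) (F l.succ)) = 0 := by
  rw [← Finset.mul_prod_erase _ _ (Finset.mem_univ l₀), E, W.ibp, if_neg hne, zero_mul, zero_add,
    W.der_prod_eq_zero]
  · simp
  · intro l hl
    have := h l (Finset.ne_of_mem_erase hl)
    rw [Ne, Sym2.eq_iff] at this
    push Not at this
    rw [W.der_A, if_neg fun h' => this.2 h'.1 h'.2, if_neg fun h' => this.1 h'.1 h'.2]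
    simp

theorem norm_ev_comm (ω : Ω) (i j : I) : ‖W.ev ω (W.A i j)‖ = ‖W.ev ω (W.A j i)‖ := by
  rw [← W.herm ω i j, norm_star]

theorem integrable_norm_pow [IsProbabilityMeasure P] (p : R) (k : ℕ) :
    Integrable (fun ω => ‖W.ev ω p‖ ^ k) P := (W.moments p).integrable_norm_pow k

/-- Write `|a|^(2(q+1)) = a · (a^q b^(q+1))` with `b` the conjugate of `a`, and integrate by parts
in `a`. The mean contributes at most half of the left side plus `m² / 2` times the lower moment;
absorbing that half doubles the derivative bound `2 v (2 q + 1)`. -/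
theorem integral_norm_pow_succ_le [IsProbabilityMeasure P] (i j : I) (q : ℕ) :
    ∫ ω, ‖W.ev ω (W.A i j)‖ ^ (2 * (q + 1)) ∂P ≤
      ((if i = j then W.mean i ^ 2 else 0) + 4 * W.v i j * (2 * q + 1)) *
        ∫ ω, ‖W.ev ω (W.A i j)‖ ^ (2 * q) ∂P := by
  have hv0 := W.v_nonneg i j
  set a := W.A i j
  set b := W.A j i
  set m : ℝ := if i = j then W.mean i else 0 with hm
  have hab : ∀ ω, ‖W.ev ω b‖ = ‖W.ev ω a‖ := fun ω => W.norm_ev_comm ω j i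
  have hU : W.E (a * (a ^ q * b ^ (q + 1))) = ((∫ ω, ‖W.ev ω a‖ ^ (2 * (q + 1)) ∂P : ℝ) : ℂ) := by
    rw [E, ← integral_complex_ofReal]
    congr 1; ext ω
    have hb : W.ev ω b = star (W.ev ω a) := (W.herm ω i j).symm
    have hn : W.ev ω a * star (W.ev ω a) = ((‖W.ev ω a‖ ^ 2 : ℝ) : ℂ) := by
      push_cast; exact RCLike.mul_conj (K := ℂ) _
    rw [map_mul, map_mul, map_pow, map_pow, hb, pow_mul, ← mul_assoc, ← pow_succ', ← mul_pow, hn]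
    push_cast; rfl
  -- On the diagonal both indicators in `der_A` are active, hence the bound `2 v`.
  obtain ⟨κ₁, hκ₁, h₁⟩ : ∃ κ : ℝ, |κ| ≤ 2 * W.v i j ∧ W.der i j b = algebraMap ℂ R κ :=
    ⟨_, by
      have h0 := W.v_nonneg i j
      have h1 := abs_le.1 (W.w_le i j)
      rw [abs_le]
      constructor <;> split_ifs <;> linarith [h1.1, h1.2], W.der_A i j j i⟩
  obtain ⟨κ₂, hκ₂, h₂⟩ : ∃ κ : ℝ, |κ| ≤ 2 * W.v i j ∧ W.der i j a = algebraMap ℂ R κ :=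
    ⟨_, by
      have h0 := W.v_nonneg i j
      have h1 := abs_le.1 (W.w_le i j)
      rw [abs_le]
      constructor <;> split_ifs <;> linarith [h1.1, h1.2], W.der_A i j i j⟩
  have hder : W.der i j (a ^ q * b ^ (q + 1)) =
      algebraMap ℂ R (((q + 1 : ℕ) : ℝ) * κ₁ : ℝ) * (a ^ q * b ^ q) +
        algebraMap ℂ R ((q : ℝ) * κ₂ : ℝ) * (a ^ (q - 1) * b ^ (q + 1)) := by
    rw [Derivation.leibniz, Derivation.leibniz_pow, Derivation.leibniz_pow, h₁, h₂]
    simp only [smul_eq_mul, nsmul_eq_mul, Nat.add_sub_cancel, Complex.ofReal_mul,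
      Complex.ofReal_natCast, map_mul, map_natCast]
    ring
  have hibp : W.E (a * (a ^ q * b ^ (q + 1))) = (m : ℂ) * W.E (a ^ q * b ^ (q + 1)) +
      W.E (W.der i j (a ^ q * b ^ (q + 1))) := by
    have := W.ibp i j (a ^ q * b ^ (q + 1))
    rw [E, this, hm]
    congr 2
    split_ifs <;> simp
  rw [hder, W.E_add, W.E_algebraMap_mul, W.E_algebraMap_mul] at hibp
  set U := ∫ ω, ‖W.ev ω a‖ ^ (2 * (q + 1)) ∂P
  set u := ∫ ω, ‖W.ev ω a‖ ^ (2 * q) ∂P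
  have hU0 : 0 ≤ U := integral_nonneg fun ω => by positivity
  have hu0 : 0 ≤ u := integral_nonneg fun ω => by positivity
  have e1 : ‖(m : ℂ) * W.E (a ^ q * b ^ (q + 1))‖ ≤ 1 / 2 * U + 1 / 2 * m ^ 2 * u := by
    have h1 : ‖W.E (a ^ q * b ^ (q + 1))‖ ≤ ∫ ω, ‖W.ev ω a‖ ^ (2 * q + 1) ∂P := by
      refine (W.norm_E_le _).trans (le_of_eq ?_)
      congr 1; ext ω
      rw [map_mul, map_pow, map_pow, norm_mul, norm_pow, norm_pow, hab, ← pow_add]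
      congr 1; omega
    rw [norm_mul, Complex.norm_real, Real.norm_eq_abs]
    refine (mul_le_mul_of_nonneg_left h1 (abs_nonneg m)).trans ?_
    rw [← integral_const_mul, ← integral_const_mul, ← integral_const_mul, ← integral_add
      ((W.integrable_norm_pow a _).const_mul _) ((W.integrable_norm_pow a _).const_mul _)]
    refine integral_mono ((W.integrable_norm_pow a _).const_mul _)
      (((W.integrable_norm_pow a _).const_mul _).add ((W.integrable_norm_pow a _).const_mul _))
      fun ω => ?_
    have h2 : 0 ≤ ‖W.ev ω a‖ ^ (2 * q) * (‖W.ev ω a‖ - |m|) ^ 2 := by positivity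
    have h3 : ‖W.ev ω a‖ ^ (2 * q) * (‖W.ev ω a‖ - |m|) ^ 2 = ‖W.ev ω a‖ ^ (2 * (q + 1)) -
        2 * (|m| * ‖W.ev ω a‖ ^ (2 * q + 1)) + m ^ 2 * ‖W.ev ω a‖ ^ (2 * q) := by
      rw [← sq_abs m]; ring
    simp only
    linarith
  have e2 : ‖W.E (a ^ q * b ^ q)‖ ≤ u := by
    refine (W.norm_E_le _).trans (le_of_eq ?_)
    congr 1; ext ω
    rw [map_mul, map_pow, map_pow, norm_mul, norm_pow, norm_pow, hab, ← pow_add, two_mul]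
  have e3 : ‖(((q : ℝ) * κ₂ : ℝ) : ℂ) * W.E (a ^ (q - 1) * b ^ (q + 1))‖ ≤
      q * (2 * W.v i j) * u := by
    rcases q with _ | q
    · simp
    · have : ‖W.E (a ^ (q + 1 - 1) * b ^ (q + 1 + 1))‖ ≤ u := by
        refine (W.norm_E_le _).trans (le_of_eq ?_)
        congr 1; ext ω
        rw [map_mul, map_pow, map_pow, norm_mul, norm_pow, norm_pow, hab, ← pow_add]
        congr 1; omega
      rw [norm_mul, Complex.norm_real, Real.norm_eq_abs, abs_mul, Nat.abs_cast]
      gcongr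
  have hfin : U ≤ (1 / 2 * U + 1 / 2 * m ^ 2 * u) +
      (((q + 1 : ℕ) : ℝ) * (2 * W.v i j) * u + q * (2 * W.v i j) * u) := by
    have h := congrArg norm hibp
    rw [hU, Complex.norm_real, Real.norm_of_nonneg hU0] at h
    refine h.le.trans ((norm_add_le _ _).trans (add_le_add e1 ((norm_add_le _ _).trans (add_le_add ?_ e3))))
    rw [norm_mul, Complex.norm_real, Real.norm_eq_abs, abs_mul, Nat.abs_cast]
    gcongr
  have hm2 : (if i = j then W.mean i ^ 2 else 0) = m ^ 2 := by
    rw [hm]; split_ifs <;> simp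
  rw [hm2]
  push_cast at hfin
  linarith

end WickMatrix

namespace WickMatrix

variable {Ω : Type*} [MeasurableSpace Ω] {P : Measure Ω} [IsProbabilityMeasure P]
  {I : Type*} [Fintype I] [DecidableEq I] [Nonempty I]
  {R : Type*} [CommRing R] [Algebra ℂ R] (W : WickMatrix P I R)

/-- Iteration of the previous inequality. Diagonal entries have size `O(1)` because of the mean, the
others `O(1/√N)`; the constant comes from `4 v (2 q + 1) ≤ 8 K k / N` for `q < k`. -/
theorem integral_norm_pow_entry_le {K D : ℝ} (hK : 0 ≤ K)
    (hv : ∀ i j, W.v i j ≤ K / Fintype.card I) (hm : ∀ i, |W.mean i| ≤ D) (k : ℕ) (i j : I)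
    {q : ℕ} (hq : q ≤ k) :
    ∫ ω, ‖W.ev ω (W.A i j)‖ ^ (2 * q) ∂P ≤
      ((D ^ 2 + 8 * K * k) * (if i = j then 1 else (Fintype.card I : ℝ)⁻¹)) ^ q := by
  have hN : (1 : ℝ) ≤ Fintype.card I := by exact_mod_cast Fintype.card_pos
  have hN' : (Fintype.card I : ℝ)⁻¹ ≤ 1 := inv_le_one_of_one_le₀ hN
  have hN0 : 0 < (Fintype.card I : ℝ)⁻¹ := by positivity
  induction q with
  | zero => simp
  | succ q ih =>
    have hq' : (q : ℝ) + 1 ≤ k := by exact_mod_cast hq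
    have h0 := W.v_nonneg i j
    have hf : (if i = j then W.mean i ^ 2 else 0) + 4 * W.v i j * (2 * q + 1) ≤
        (D ^ 2 + 8 * K * k) * (if i = j then 1 else (Fintype.card I : ℝ)⁻¹) := by
      have h1 : 4 * W.v i j * (2 * q + 1) ≤ 8 * K * k * (Fintype.card I : ℝ)⁻¹ := by
        have := hv i j
        rw [div_eq_mul_inv] at this
        calc 4 * W.v i j * (2 * q + 1) ≤ 4 * (K * (Fintype.card I : ℝ)⁻¹) * (2 * k) := by
              gcongr; linarith
          _ = _ := by ring
      have h2 : W.mean i ^ 2 ≤ D ^ 2 := sq_le_sq' (abs_le.1 (hm i)).1 (abs_le.1 (hm i)).2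
      have h3 : 0 ≤ 8 * K * k := by positivity
      split_ifs
      · nlinarith
      · nlinarith [mul_nonneg (sq_nonneg D) hN0.le]
    have hf0 : 0 ≤ (if i = j then W.mean i ^ 2 else 0) + 4 * W.v i j * (2 * q + 1) := by
      have : 0 ≤ (if i = j then W.mean i ^ 2 else 0) := by split_ifs <;> positivity
      positivity
    refine (W.integral_norm_pow_succ_le i j q).trans ?_
    rw [pow_succ' ((D ^ 2 + 8 * K * k) * _)]
    exact mul_le_mul hf (ih (by omega)) (integral_nonneg fun ω => by positivity) (hf0.trans hf)

/-- A surviving path uses each non-loop edge at least twice, so it has at least `2 (#vertices - 1)`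
non-loop steps, each contributing a factor `N^(-1/2)`. -/
theorem norm_E_prod_path_le {K D : ℝ} (hK : 0 ≤ K)
    (hv : ∀ i j, W.v i j ≤ K / Fintype.card I) (hm : ∀ i, |W.mean i| ≤ D) {k : ℕ}
    (F : Fin (k + 1) → I) :
    ‖W.E (∏ l : Fin k, W.A (F l.castSucc) (F l.succ))‖ ≤
      (1 + k * (D ^ 2 + 8 * K * k) ^ k) *
        (Fintype.card I : ℝ)⁻¹ ^ ((Finset.univ.image F).card - 1) := by
  have hN : (1 : ℝ) ≤ Fintype.card I := by exact_mod_cast Fintype.card_pos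
  have hN' : (Fintype.card I : ℝ)⁻¹ ≤ 1 := inv_le_one_of_one_le₀ hN
  have hN0 : 0 < (Fintype.card I : ℝ)⁻¹ := by positivity
  set x := (Fintype.card I : ℝ)⁻¹
  by_cases hz : ∃ l₀ : Fin k, F l₀.castSucc ≠ F l₀.succ ∧
      ∀ l ≠ l₀, s(F l.castSucc, F l.succ) ≠ s(F l₀.castSucc, F l₀.succ)
  · obtain ⟨l₀, hne, h⟩ := hz
    rw [W.E_prod_path_eq_zero F l₀ hne h, norm_zero]
    positivity
  · push Not at hz
    have hcard := two_mul_card_pathEdges_le F hz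
    have hverts := card_image_le_card_pathEdges F
    -- The natural scale of the squared entry: after division by `√(c l)` all factors have moments
    -- of order one.
    let c : Fin k → ℝ := fun l => if F l.castSucc = F l.succ then 1 else x
    have hc : ∀ l, 0 < c l := fun l => by simp only [c]; split_ifs <;> positivity
    have hprod : ∏ l, √(c l) ≤ x ^ ((Finset.univ.image F).card - 1) := by
      have h1 : ∏ l, √(c l) =
          √x ^ (Finset.univ.filter fun l : Fin k => F l.castSucc ≠ F l.succ).card := by
        have : ∀ l, √(c l) = if F l.castSucc ≠ F l.succ then √x else 1 := fun l => by
          simp only [c]; split_ifs <;> simp_all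
        simp only [this]
        rw [Finset.prod_ite, Finset.prod_const, Finset.prod_const_one, mul_one]
      have hx1 : √x ≤ 1 := Real.sqrt_le_one.2 hN'
      rw [h1]
      calc _ ≤ √x ^ (2 * (pathEdges F).card) := pow_le_pow_of_le_one (Real.sqrt_nonneg _) hx1 hcard
        _ = x ^ (pathEdges F).card := by rw [pow_mul, Real.sq_sqrt hN0.le]
        _ ≤ _ := pow_le_pow_of_le_one hN0.le hN' (by omega)
    have hpt : ∀ ω, ‖W.ev ω (∏ l : Fin k, W.A (F l.castSucc) (F l.succ))‖ ≤
        (∏ l, √(c l)) * (1 + ∑ l, (c l ^ k)⁻¹ * ‖W.ev ω (W.A (F l.castSucc) (F l.succ))‖ ^ (2 * k)) := by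
      intro ω
      have h1 := prod_le_one_add_sum_pow
        (x := fun l => ‖W.ev ω (W.A (F l.castSucc) (F l.succ))‖ / √(c l))
        fun l => by positivity
      have h2 : ‖W.ev ω (∏ l : Fin k, W.A (F l.castSucc) (F l.succ))‖ = (∏ l, √(c l)) *
          ∏ l, (‖W.ev ω (W.A (F l.castSucc) (F l.succ))‖ / √(c l)) := by
        rw [map_prod, norm_prod, ← Finset.prod_mul_distrib]
        refine Finset.prod_congr rfl fun l _ => ?_
        have := (Real.sqrt_pos.2 (hc l)).ne'
        field_simp
      rw [h2]
      refine mul_le_mul_of_nonneg_left (h1.trans (le_of_eq ?_))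
        (Finset.prod_nonneg fun l _ => Real.sqrt_nonneg _)
      congr 1
      refine Finset.sum_congr rfl fun l _ => ?_
      rw [div_pow, pow_mul (√(c l)), Real.sq_sqrt (hc l).le]
      ring
    have hint : Integrable (fun ω => 1 + ∑ l, (c l ^ k)⁻¹ *
        ‖W.ev ω (W.A (F l.castSucc) (F l.succ))‖ ^ (2 * k)) P :=
      (integrable_const 1).add (integrable_finsetSum _ fun l _ =>
        (W.integrable_norm_pow _ _).const_mul _)
    calc ‖W.E (∏ l : Fin k, W.A (F l.castSucc) (F l.succ))‖
        ≤ ∫ ω, (∏ l, √(c l)) * (1 + ∑ l, (c l ^ k)⁻¹ *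
          ‖W.ev ω (W.A (F l.castSucc) (F l.succ))‖ ^ (2 * k)) ∂P :=
          norm_integral_le_of_norm_le (hint.const_mul _) (ae_of_all _ hpt)
      _ = (∏ l, √(c l)) * (1 + ∑ l, (c l ^ k)⁻¹ *
          ∫ ω, ‖W.ev ω (W.A (F l.castSucc) (F l.succ))‖ ^ (2 * k) ∂P) := by
          rw [integral_const_mul, integral_add (integrable_const 1) (integrable_finsetSum _
            fun l _ => (W.integrable_norm_pow _ _).const_mul _), integral_finsetSum _
            fun l _ => (W.integrable_norm_pow _ _).const_mul _]
          simp [integral_const_mul]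
      _ ≤ (∏ l, √(c l)) * (1 + ∑ l : Fin k, (D ^ 2 + 8 * K * k) ^ k) := by
          refine mul_le_mul_of_nonneg_left (add_le_add le_rfl (Finset.sum_le_sum fun l _ => ?_))
            (Finset.prod_nonneg fun l _ => Real.sqrt_nonneg _)
          rw [inv_mul_le_iff₀ (pow_pos (hc l) k), ← mul_pow, mul_comm (c l)]
          exact W.integral_norm_pow_entry_le hK hv hm k _ _ le_rfl
      _ ≤ _ := by
          rw [Finset.sum_const, Finset.card_univ, Fintype.card_fin, nsmul_eq_mul, mul_comm]
          exact mul_le_mul_of_nonneg_left hprod (by positivity)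

/-- The starting point `i` is fixed and costs no factor, so the path bounds sum to a constant
independent of the matrix size. -/
theorem norm_E_pow_diag_le {K D : ℝ} (hK : 0 ≤ K)
    (hv : ∀ i j, W.v i j ≤ K / Fintype.card I) (hm : ∀ i, |W.mean i| ≤ D) (k : ℕ) (i : I) :
    ‖W.E ((W.A ^ k) i i)‖ ≤ (1 + k * (D ^ 2 + 8 * K * k) ^ k) * ((k : ℝ) + 2) ^ k := by
  have hN : (0 : ℝ) < Fintype.card I := by exact_mod_cast Fintype.card_pos
  set x := (Fintype.card I : ℝ)⁻¹ with hx
  have hx0 : 0 < x := by positivity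
  rw [matrix_pow_apply_eq_sum, W.E_sum]
  have hg : ∀ g : Fin k → I, Finset.univ.image (Fin.cons i g : Fin (k + 1) → I) =
      {i} ∪ Finset.univ.image g := fun g => by
    ext y
    simp only [Finset.mem_union, Finset.mem_image, Finset.mem_univ, true_and,
      Fin.exists_fin_succ, Fin.cons_zero, Fin.cons_succ, Finset.mem_singleton]
    tauto
  have h1 : ∀ g : Fin k → I, ‖W.E (if (Fin.cons i g : Fin (k + 1) → I) (Fin.last k) = i then
        ∏ l : Fin k, W.A ((Fin.cons i g : Fin (k + 1) → I) l.castSucc)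
          ((Fin.cons i g : Fin (k + 1) → I) l.succ) else 0)‖ ≤
      (1 + k * (D ^ 2 + 8 * K * k) ^ k) *
        (x⁻¹ * x ^ ({i} ∪ Finset.univ.image g).card) := fun g => by
    -- The path contains `i`; hence the truncated `card - 1` is a genuine predecessor and can be
    -- written with `x⁻¹`.
    have hpos : 0 < ({i} ∪ Finset.univ.image g).card :=
      Finset.card_pos.2 ⟨i, by simp⟩
    have h2 : x⁻¹ * x ^ ({i} ∪ Finset.univ.image g).card =
        x ^ (({i} ∪ Finset.univ.image g).card - 1) := by
      obtain ⟨m, hm⟩ := Nat.exists_eq_succ_of_ne_zero hpos.ne'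
      rw [hm, pow_succ', inv_mul_cancel_left₀ hx0.ne']
      simp
    rw [h2]
    split_ifs
    · rw [← hg]
      exact W.norm_E_prod_path_le hK hv hm _
    · simp only [E, map_zero, integral_zero, norm_zero]
      positivity
  refine (norm_sum_le _ _).trans ((Finset.sum_le_sum fun g _ => h1 g).trans ?_)
  rw [← Finset.mul_sum, ← Finset.mul_sum]
  refine mul_le_mul_of_nonneg_left ?_ (by positivity)
  have h3 := sum_pow_card_union_image_le hx0.le (by rw [hx, mul_inv_cancel₀ hN.ne']) k ({i} : Finset I)
  rw [Finset.card_singleton, pow_one] at h3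
  rw [inv_mul_le_iff₀ hx0]
  refine h3.trans (le_of_eq ?_)
  push_cast
  ring

end WickMatrix

/-! ### Uniform limits over the indices of growing matrices -/

/-- The filter on pairs `(n, i)` with `i : Fin n` for which `n` tends to infinity. -/
def indexFilter : Filter (Σ n : ℕ, Fin n) := comap Sigma.fst atTop

theorem tendsto_fst_indexFilter : Tendsto Sigma.fst indexFilter atTop := tendsto_comap

theorem tendsto_zero_of_bounded_mul {κ : Type*} {l : Filter κ} {c f : κ → ℂ} {C : ℝ}
    (hc : ∀ x, ‖c x‖ ≤ C) (hf : Tendsto f l (𝓝 0)) : Tendsto (fun x => c x * f x) l (𝓝 0) := by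
  refine squeeze_zero_norm (a := fun x => C * ‖f x‖) (fun x => ?_) ?_
  · rw [norm_mul]
    exact mul_le_mul_of_nonneg_right (hc x) (norm_nonneg _)
  · simpa using hf.norm.const_mul C

/-- Convergence along `indexFilter` is uniform in the index, so it survives averaging over arbitrary
subsets, including sets of size `o(n)`. Over an empty set the average is zero. -/
theorem tendsto_average {g : (Σ n : ℕ, Fin n) → ℂ} (hg : Tendsto g indexFilter (𝓝 0))
    (s : (n : ℕ) → Finset (Fin n)) :
    Tendsto (fun n => ((s n).card : ℂ)⁻¹ * ∑ j ∈ s n, g ⟨n, j⟩) atTop (𝓝 0) := by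
  rw [Metric.tendsto_nhds] at hg ⊢
  intro ε hε
  have h := hg (ε / 2) (half_pos hε)
  rw [indexFilter, eventually_comap] at h
  filter_upwards [h] with n hn
  rw [dist_zero_right, norm_mul, norm_inv, Complex.norm_natCast]
  have h1 : ‖∑ j ∈ s n, g ⟨n, j⟩‖ ≤ (s n).card * (ε / 2) := by
    refine (norm_sum_le _ _).trans ((Finset.sum_le_sum (g := fun _ => ε / 2)
      fun j _ => ?_).trans (le_of_eq ?_))
    · have := hn ⟨n, j⟩ rfl
      rw [dist_zero_right] at this
      exact this.le
    · simp
  rcases Nat.eq_zero_or_pos (s n).card with h0 | h0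
  · simp [h0, hε]
  · have h0' : (0 : ℝ) < (s n).card := by exact_mod_cast h0
    calc _ ≤ ((s n).card : ℝ)⁻¹ * ((s n).card * (ε / 2)) := by gcongr
      _ = ε / 2 := by field_simp
      _ < ε := half_lt_self hε

/-! ### Bounded moments and the vanishing error terms. -/

section Limit

variable {Ω : ℕ → Type*} [∀ n, MeasurableSpace (Ω n)] {P : (n : ℕ) → Measure (Ω n)}
  [∀ n, IsProbabilityMeasure (P n)] {R : ℕ → Type*} [∀ n, CommRing (R n)]
  [∀ n, Algebra ℂ (R n)] (W : (n : ℕ) → WickMatrix (P n) (Fin n) (R n))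

/-- Families of random variables with uniformly bounded absolute moments. -/
def MomentBounded (Z : (x : Σ n : ℕ, Fin n) → R x.1) : Prop :=
  ∀ r : ℕ, ∃ C : ℝ, ∀ x, ∫ ω, ‖(W x.1).ev ω (Z x)‖ ^ r ∂(P x.1) ≤ C

variable {W}

theorem MomentBounded.one : MomentBounded W fun _ => 1 := fun r => ⟨1, fun x => by simp⟩

theorem MomentBounded.mul {Z₁ Z₂ : (x : Σ n : ℕ, Fin n) → R x.1} (h₁ : MomentBounded W Z₁)
    (h₂ : MomentBounded W Z₂) : MomentBounded W fun x => Z₁ x * Z₂ x := fun r => by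
  obtain ⟨C₁, hC₁⟩ := h₁ (2 * r)
  obtain ⟨C₂, hC₂⟩ := h₂ (2 * r)
  refine ⟨C₁ + C₂, fun x => le_trans ?_ (add_le_add (hC₁ x) (hC₂ x))⟩
  have hi := fun Z => (W x.1).integrable_norm_pow Z
  rw [← integral_add (hi _ _) (hi _ _)]
  refine integral_mono (hi _ _) ((hi _ _).add (hi _ _)) fun ω => ?_
  simp only [map_mul, norm_mul, mul_pow, mul_comm 2 r, pow_mul]
  nlinarith [sq_nonneg (‖(W x.1).ev ω (Z₁ x)‖ ^ r - ‖(W x.1).ev ω (Z₂ x)‖ ^ r),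
    sq_nonneg (‖(W x.1).ev ω (Z₁ x)‖ ^ r), sq_nonneg (‖(W x.1).ev ω (Z₂ x)‖ ^ r)]

variable (W) in
/-- The matrices have entrywise variances of order `1 / n` and bounded means. -/
structure HasBoundedProfile (K D : ℝ) : Prop where
  nonneg : 0 ≤ K
  v_le : ∀ n i j, (W n).v i j ≤ K / n
  mean_le : ∀ n i, |(W n).mean i| ≤ D

variable {K D : ℝ}

/-- A diagonal entry of an even power is nonnegative, so its absolute moment is its expectation,
already bounded. Such an entry dominates the `r`-th absolute power up to the additive constant `1`.
-/
theorem momentBounded_diag (hW : HasBoundedProfile W K D) (a : ℕ) :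
    MomentBounded W fun x => ((W x.1).A ^ a) x.2 x.2 := fun r => by
  set k := 2 ^ (r + 1) * a
  refine ⟨1 + (1 + k * (D ^ 2 + 8 * K * k) ^ k) * ((k : ℝ) + 2) ^ k, fun x => ?_⟩
  have : Nonempty (Fin x.1) := ⟨x.2⟩
  have hb := (W x.1).norm_E_pow_diag_le hW.nonneg (by simpa using hW.v_le x.1) (hW.mean_le x.1)
    k x.2
  have hnorm : ∫ ω, ‖(W x.1).ev ω (((W x.1).A ^ k) x.2 x.2)‖ ∂(P x.1) ≤
      ‖(W x.1).E (((W x.1).A ^ k) x.2 x.2)‖ := by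
    have h1 : ∀ ω, (W x.1).ev ω (((W x.1).A ^ k) x.2 x.2) =
        ((‖(W x.1).ev ω (((W x.1).A ^ k) x.2 x.2)‖ : ℝ) : ℂ) := fun ω => by
      have hk : k = 2 ^ r * a + 2 ^ r * a := by simp only [k]; ring
      rw [WickMatrix.ev_pow_apply, hk, pow_add]
      have hH := ((W x.1).isHermitian_mat ω).pow (2 ^ r * a)
      rw [norm_mul_self_diag_of_isHermitian hH, ← mul_self_diag_of_isHermitian hH]
    rw [WickMatrix.E, integral_congr_ae (ae_of_all _ h1), integral_complex_ofReal,
      Complex.norm_real]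
    exact le_abs_self _
  refine le_trans ?_ (add_le_add le_rfl (hnorm.trans hb))
  have hi := fun Z => (W x.1).integrable_norm_pow Z
  have hi1 := ((W x.1).integrable (((W x.1).A ^ k) x.2 x.2)).norm
  have h1 : (1 : ℝ) = ∫ _, (1 : ℝ) ∂(P x.1) := by simp
  rw [h1, ← integral_add (integrable_const _) hi1]
  refine integral_mono (hi _ _) ((integrable_const _).add hi1) fun ω => ?_
  have h2 := norm_diag_pow_le_of_isHermitian ((W x.1).isHermitian_mat ω) a (r + 1) x.2
  rw [← WickMatrix.ev_pow_apply, ← WickMatrix.ev_pow_apply] at h2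
  simp only
  refine le_trans ?_ (add_le_add le_rfl h2)
  have hr : r ≤ 2 ^ (r + 1) := (Nat.lt_two_pow_self.le).trans (Nat.pow_le_pow_right two_pos (by omega))
  rcases le_total ‖(W x.1).ev ω (((W x.1).A ^ a) x.2 x.2)‖ 1 with h | h
  · have := pow_le_one₀ (n := r) (norm_nonneg _) h
    have : 0 ≤ ‖(W x.1).ev ω (((W x.1).A ^ a) x.2 x.2)‖ ^ 2 ^ (r + 1) := by positivity
    linarith
  · have := pow_le_pow_right₀ h hr
    linarith

variable (W) in
/-- The normalized trace of a power. -/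
noncomputable def ntr (n a : ℕ) : R n :=
  algebraMap ℂ (R n) ((n : ℂ)⁻¹) * ((W n).A ^ a).trace

/-- Convexity of the `r`-th power reduces the average to its diagonal entries. -/
theorem momentBounded_ntr (hW : HasBoundedProfile W K D) (a : ℕ) :
    MomentBounded W fun x => ntr W x.1 a := fun r => by
  obtain ⟨C, hC⟩ := momentBounded_diag hW a r
  refine ⟨C, fun x => ?_⟩
  obtain ⟨n, i⟩ := x
  have hn : (0 : ℝ) < n := by exact_mod_cast i.pos
  have hi := fun Z => (W n).integrable_norm_pow Z
  have hsum : ∑ _j : Fin n, (n : ℝ)⁻¹ = 1 := by simp [hn.ne']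
  have hpt : ∀ ω, ‖(W n).ev ω (ntr W n a)‖ ^ r ≤
      ∑ j : Fin n, (n : ℝ)⁻¹ * ‖(W n).ev ω (((W n).A ^ a) j j)‖ ^ r := fun ω => by
    refine le_trans (pow_le_pow_left₀ (norm_nonneg _) ?_ r)
      (Real.pow_arith_mean_le_arith_mean_pow Finset.univ (fun _ : Fin n => (n : ℝ)⁻¹)
        (fun j => ‖(W n).ev ω (((W n).A ^ a) j j)‖) (fun _ _ => by positivity) hsum
        (fun _ _ => norm_nonneg _) r)
    simp only [ntr, map_mul, AlgHom.commutes, Algebra.algebraMap_self, RingHom.id_apply, norm_mul,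
      norm_inv, Complex.norm_natCast, Matrix.trace, map_sum, Matrix.diag_apply]
    rw [← Finset.mul_sum]
    exact mul_le_mul_of_nonneg_left (norm_sum_le _ _) (by positivity)
  have hint : Integrable (fun ω => ∑ j : Fin n, (n : ℝ)⁻¹ *
      ‖(W n).ev ω (((W n).A ^ a) j j)‖ ^ r) (P n) :=
    integrable_finsetSum _ fun j _ => (hi _ _).const_mul _
  calc _ ≤ ∫ ω, ∑ j : Fin n, (n : ℝ)⁻¹ * ‖(W n).ev ω (((W n).A ^ a) j j)‖ ^ r ∂(P n) :=
        integral_mono (hi _ _) hint hpt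
    _ = ∑ j : Fin n, (n : ℝ)⁻¹ * ∫ ω, ‖(W n).ev ω (((W n).A ^ a) j j)‖ ^ r ∂(P n) := by
        rw [integral_finsetSum _ fun j _ => (hi _ _).const_mul _]
        simp only [integral_const_mul]
    _ ≤ ∑ _j : Fin n, (n : ℝ)⁻¹ * C := Finset.sum_le_sum fun j _ =>
        mul_le_mul_of_nonneg_left (hC ⟨n, j⟩) (by positivity)
    _ = C := by rw [← Finset.sum_mul, hsum, one_mul]

variable (W) in
/-- A product of normalized traces of powers. -/
noncomputable def ntrProd (n : ℕ) (as : List ℕ) : R n := (as.map (ntr W n)).prod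

theorem momentBounded_ntrProd (hW : HasBoundedProfile W K D) (as : List ℕ) :
    MomentBounded W fun x => ntrProd W x.1 as := by
  induction as with
  | nil => simpa [ntrProd] using MomentBounded.one
  | cons a as ih => simpa [ntrProd] using (momentBounded_ntr hW a).mul ih

theorem tendsto_const_div_indexFilter (C : ℝ) :
    Tendsto (fun x : Σ n : ℕ, Fin n => C / (x.1 : ℝ)) indexFilter (𝓝 0) :=
  (tendsto_const_div_atTop_nhds_zero_nat C).comp tendsto_fst_indexFilter

/-- The sum over `j` of the products of the entries `(j, i)` of `A^a` and `A^c` is controlled by the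
diagonal entries of `A^(2a)` and `A^(2c)` at `i`. It is therefore bounded in mean, and the
coefficients supply a factor `1/n`. -/
theorem tendsto_sum_offdiag (hW : HasBoundedProfile W K D) {Z : (x : Σ n : ℕ, Fin n) → R x.1}
    (hZ : MomentBounded W Z) (a c : ℕ) {C : ℝ} (u : (x : Σ n : ℕ, Fin n) → Fin x.1 → ℂ)
    (hu : ∀ x j, ‖u x j‖ ≤ C / x.1) (p : (x : Σ n : ℕ, Fin n) → Fin x.1 → R x.1)
    (hp : ∀ x j ω, ‖(W x.1).ev ω (p x j)‖ ≤ ‖(W x.1).ev ω (((W x.1).A ^ a) j x.2)‖ *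
      ‖(W x.1).ev ω (((W x.1).A ^ c) j x.2)‖ * ‖(W x.1).ev ω (Z x)‖) :
    Tendsto (fun x => ∑ j, u x j * (W x.1).E (p x j)) indexFilter (𝓝 0) := by
  obtain ⟨C₁, hC₁⟩ := ((momentBounded_diag hW (a + a)).mul hZ) 1
  obtain ⟨C₂, hC₂⟩ := ((momentBounded_diag hW (c + c)).mul hZ) 1
  refine squeeze_zero_norm (a := fun x => C / x.1 * (C₁ + C₂)) (fun x => ?_) ?_
  · have hC : 0 ≤ C / x.1 := (norm_nonneg _).trans (hu x x.2)
    have hi := fun Z => ((W x.1).integrable Z).norm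
    have h1 : ∑ j, u x j * (W x.1).E (p x j) = ∫ ω, ∑ j, u x j * (W x.1).ev ω (p x j) ∂(P x.1) := by
      rw [integral_finsetSum _ fun j _ => ((W x.1).integrable _).const_mul _]
      simp only [integral_const_mul, WickMatrix.E]
    rw [h1]
    have hpt : ∀ ω, ‖∑ j, u x j * (W x.1).ev ω (p x j)‖ ≤ C / x.1 *
        (‖(W x.1).ev ω (((W x.1).A ^ (a + a)) x.2 x.2 * Z x)‖ +
          ‖(W x.1).ev ω (((W x.1).A ^ (c + c)) x.2 x.2 * Z x)‖) := fun ω => by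
      have hcs := sum_norm_mul_norm_le_of_isHermitian (((W x.1).isHermitian_mat ω).pow a)
        (((W x.1).isHermitian_mat ω).pow c) x.2
      rw [← pow_add, ← pow_add] at hcs
      simp only [← WickMatrix.ev_pow_apply] at hcs
      calc _ ≤ ∑ j, C / x.1 * (‖(W x.1).ev ω (((W x.1).A ^ a) j x.2)‖ *
              ‖(W x.1).ev ω (((W x.1).A ^ c) j x.2)‖ * ‖(W x.1).ev ω (Z x)‖) := by
            refine (norm_sum_le _ _).trans (Finset.sum_le_sum fun j _ => ?_)
            rw [norm_mul]
            exact mul_le_mul (hu x j) (hp x j ω) (norm_nonneg _) hC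
        _ = C / x.1 * ((∑ j, ‖(W x.1).ev ω (((W x.1).A ^ a) j x.2)‖ *
              ‖(W x.1).ev ω (((W x.1).A ^ c) j x.2)‖) * ‖(W x.1).ev ω (Z x)‖) := by
            rw [← Finset.mul_sum, Finset.sum_mul]
        _ ≤ _ := by
            refine mul_le_mul_of_nonneg_left ?_ hC
            rw [map_mul, map_mul, norm_mul, norm_mul, ← add_mul]
            exact mul_le_mul_of_nonneg_right hcs (norm_nonneg _)
    refine (norm_integral_le_of_norm_le (((hi _).add (hi _)).const_mul _)
      (ae_of_all _ hpt)).trans ?_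
    rw [integral_const_mul, integral_add' (hi _) (hi _)]
    have e1 := hC₁ x
    have e2 := hC₂ x
    simp only [pow_one] at e1 e2
    exact mul_le_mul_of_nonneg_left (add_le_add e1 e2) hC
  · simpa using (tendsto_const_div_indexFilter C).mul_const (C₁ + C₂)

theorem norm_ev_pow_comm {n : ℕ} (ω : Ω n) (k : ℕ) (i j : Fin n) :
    ‖(W n).ev ω (((W n).A ^ k) i j)‖ = ‖(W n).ev ω (((W n).A ^ k) j i)‖ := by
  rw [WickMatrix.ev_pow_apply, WickMatrix.ev_pow_apply,
    norm_apply_comm_of_isHermitian (((W n).isHermitian_mat ω).pow k)]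

theorem HasBoundedProfile.abs_v_le (hW : HasBoundedProfile W K D) (n : ℕ) (i j : Fin n) :
    ‖((W n).v i j : ℂ)‖ ≤ K / n := by
  rw [Complex.norm_real, Real.norm_of_nonneg ((W n).v_nonneg i j)]
  exact hW.v_le n i j

theorem HasBoundedProfile.abs_w_le (hW : HasBoundedProfile W K D) (n : ℕ) (i j : Fin n) :
    ‖((W n).w i j : ℂ)‖ ≤ K / n := by
  rw [Complex.norm_real]
  exact ((W n).w_le i j).trans (hW.v_le n i j)

/-- Differentiating a normalized trace produces off-diagonal entries, to which the preceding
estimate applies. The extra `1/n` from the normalization is not needed and is bounded by `1`. -/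
theorem tendsto_sum_der_ntrProd (hW : HasBoundedProfile W K D) (k : ℕ) (as : List ℕ)
    {Z : (x : Σ n : ℕ, Fin n) → R x.1} (hZ : MomentBounded W Z) :
    Tendsto (fun x => ∑ j, (W x.1).E (((W x.1).A ^ k) j x.2 *
      (W x.1).der x.2 j (ntrProd W x.1 as) * Z x)) indexFilter (𝓝 0) := by
  -- When the derivation hits the tail, the undifferentiated first trace is absorbed into `Z`.
  induction as generalizing Z with
  | nil =>
    simp only [ntrProd, List.map_nil, List.prod_nil, Derivation.map_one_eq_zero, mul_zero, zero_mul,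
      WickMatrix.E, map_zero, integral_zero, Finset.sum_const_zero]
    exact tendsto_const_nhds
  | cons a as ih =>
    have hZ' : MomentBounded W fun x => ntrProd W x.1 as * Z x := (momentBounded_ntrProd hW as).mul hZ
    have hcoef : ∀ (x : Σ n : ℕ, Fin n) (z : ℂ), ‖z‖ ≤ K / x.1 →
        ‖((x.1 : ℂ)⁻¹ * a) * z‖ ≤ a * K / x.1 := fun x z hz => by
      have hn : (1 : ℝ) ≤ x.1 := by exact_mod_cast x.2.pos
      rw [norm_mul, norm_mul, norm_inv, Complex.norm_natCast, Complex.norm_natCast, mul_div_assoc]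
      have : (x.1 : ℝ)⁻¹ ≤ 1 := inv_le_one_of_one_le₀ hn
      refine mul_le_mul ?_ hz (norm_nonneg _) (by positivity)
      nlinarith [(Nat.cast_nonneg a : (0 : ℝ) ≤ a)]
    have h1 := ih (Z := fun x => ntr W x.1 a * Z x) ((momentBounded_ntr hW a).mul hZ)
    have h2 := tendsto_sum_offdiag hW hZ' k (a - 1)
      (fun x j => ((x.1 : ℂ)⁻¹ * a) * (W x.1).v x.2 j)
      (fun x j => hcoef x _ (hW.abs_v_le x.1 x.2 j))
      (fun x j => ((W x.1).A ^ k) j x.2 * ((W x.1).A ^ (a - 1)) x.2 j *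
        (ntrProd W x.1 as * Z x))
      (fun x j ω => by
        rw [map_mul, map_mul, norm_mul, norm_mul, norm_ev_pow_comm ω (a - 1) x.2 j])
    have h3 := tendsto_sum_offdiag hW hZ' k (a - 1)
      (fun x j => ((x.1 : ℂ)⁻¹ * a) * (W x.1).w x.2 j)
      (fun x j => hcoef x _ (hW.abs_w_le x.1 x.2 j))
      (fun x j => ((W x.1).A ^ k) j x.2 * ((W x.1).A ^ (a - 1)) j x.2 *
        (ntrProd W x.1 as * Z x))
      (fun x j ω => by rw [map_mul, map_mul, norm_mul, norm_mul])
    have := (h1.add h2).add h3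
    simp only [add_zero] at this
    refine this.congr fun x => ?_
    rw [← Finset.sum_add_distrib, ← Finset.sum_add_distrib]
    refine Finset.sum_congr rfl fun j _ => ?_
    rw [← WickMatrix.E_algebraMap_mul, ← WickMatrix.E_algebraMap_mul, ← WickMatrix.E_add,
      ← WickMatrix.E_add]
    congr 1
    have hcons : ntrProd W x.1 (a :: as) = ntr W x.1 a * ntrProd W x.1 as := by simp [ntrProd]
    have hder : (W x.1).der x.2 j (ntr W x.1 a) = algebraMap ℂ (R x.1) ((x.1 : ℂ)⁻¹) *
        (a * (algebraMap ℂ (R x.1) ((W x.1).v x.2 j) * ((W x.1).A ^ (a - 1)) x.2 j +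
          algebraMap ℂ (R x.1) ((W x.1).w x.2 j) * ((W x.1).A ^ (a - 1)) j x.2)) := by
      rw [ntr, Derivation.leibniz, Derivation.map_algebraMap, smul_zero, add_zero, smul_eq_mul,
        WickMatrix.der_trace_pow]
    rw [hcons, Derivation.leibniz, hder, smul_eq_mul, smul_eq_mul]
    simp only [map_mul, map_natCast]
    ring

end Limit

/-! ### Passage to the limit in the Schwinger–Dyson equation. -/

section BlockLimit

variable {Ω : ℕ → Type*} [∀ n, MeasurableSpace (Ω n)] {P : (n : ℕ) → Measure (Ω n)}
  [∀ n, IsProbabilityMeasure (P n)] {R : ℕ → Type*} [∀ n, CommRing (R n)]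
  [∀ n, Algebra ℂ (R n)] {W : (n : ℕ) → WickMatrix (P n) (Fin n) (R n)}
  {K D : ℝ} {blk : (n : ℕ) → Fin n → Fin 2} {V : Matrix (Fin 2) (Fin 2) ℝ} {α : Fin 2 → ℝ}

theorem exists_norm_E_diag_mul_le (hW : HasBoundedProfile W K D)
    {Z : (x : Σ n : ℕ, Fin n) → R x.1} (hZ : MomentBounded W Z) (a : ℕ) :
    ∃ C : ℝ, ∀ (x : Σ n : ℕ, Fin n) (j : Fin x.1),
      ‖(W x.1).E (((W x.1).A ^ a) j j * Z x)‖ ≤ C := by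
  obtain ⟨C₁, hC₁⟩ := momentBounded_diag hW a 2
  obtain ⟨C₂, hC₂⟩ := hZ 2
  refine ⟨C₁ + C₂, fun x j => ?_⟩
  have hi := fun Z => (W x.1).integrable_norm_pow Z 2
  refine (norm_integral_le_of_norm_le (g := fun ω => ‖(W x.1).ev ω (((W x.1).A ^ a) j j)‖ ^ 2 +
    ‖(W x.1).ev ω (Z x)‖ ^ 2) ((hi _).add (hi _)) (ae_of_all _ fun ω => ?_)).trans ?_
  · rw [map_mul, norm_mul]
    nlinarith [sq_nonneg (‖(W x.1).ev ω (((W x.1).A ^ a) j j)‖ - ‖(W x.1).ev ω (Z x)‖),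
      sq_nonneg ‖(W x.1).ev ω (((W x.1).A ^ a) j j)‖, sq_nonneg ‖(W x.1).ev ω (Z x)‖]
  · rw [integral_add (hi _) (hi _)]
    exact add_le_add (hC₁ ⟨x.1, j⟩) (hC₂ x)

theorem tendsto_card_part_indexFilter
    (hd : Tendsto (fun n : ℕ => ((part (blk n) 0).card : ℝ) / n) atTop (𝓝 0)) (C : ℝ) :
    Tendsto (fun x : Σ n : ℕ, Fin n => ((part (blk x.1) 0).card : ℝ) / x.1 * C) indexFilter
      (𝓝 0) := by
  simpa using (hd.comp tendsto_fst_indexFilter).mul_const C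

theorem norm_sum_le_card_part {n : ℕ} (b : Fin n → Fin 2) (f : Fin n → ℂ) {C : ℝ}
    (h0 : ∀ j, b j = 0 → ‖f j‖ ≤ C) (h1 : ∀ j, b j = 1 → f j = 0) :
    ‖∑ j, f j‖ ≤ (part b 0).card * C := by
  have : ∑ j, f j = ∑ j ∈ part b 0, f j := by
    refine (Finset.sum_subset (Finset.subset_univ _) fun j _ hj => h1 j ?_).symm
    simp only [part, Finset.mem_filter, Finset.mem_univ, true_and] at hj
    omega
  rw [this]
  refine (norm_sum_le_of_le _ (f := f) (n := fun _ => C) fun j hj => h0 j ?_).trans (by simp)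
  exact (Finset.mem_filter.1 hj).2

/-- Replacing `v i j` by its value for `j` in the second block changes only the terms with `j` in
the first block: `|N_1|` terms of size `O(1/n)`. This is where the vanishing asymptotic dimension of
that block is used. -/
theorem tendsto_sum_diag (hW : HasBoundedProfile W K D)
    (hv : ∀ n i j, (W n).v i j = V (blk n i) (blk n j) / n)
    (hd : Tendsto (fun n : ℕ => ((part (blk n) 0).card : ℝ) / n) atTop (𝓝 0))
    {Z : (x : Σ n : ℕ, Fin n) → R x.1} (hZ : MomentBounded W Z) (a : ℕ) :
    Tendsto (fun x => ∑ j, ((W x.1).v x.2 j : ℂ) * (W x.1).E (((W x.1).A ^ a) j j * Z x) -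
      (V (blk x.1 x.2) 1 : ℂ) * (W x.1).E (ntr W x.1 a * Z x)) indexFilter (𝓝 0) := by
  obtain ⟨C, hC⟩ := exists_norm_E_diag_mul_le hW hZ a
  set B : ℝ := ∑ p, |V p 0 - V p 1|
  refine squeeze_zero_norm (fun x => ?_) (tendsto_card_part_indexFilter hd (B * C))
  have hn : (0 : ℝ) < x.1 := by exact_mod_cast x.2.pos
  have hB0 : 0 ≤ B := Finset.sum_nonneg fun p _ => abs_nonneg _
  have h1 : (W x.1).E (ntr W x.1 a * Z x) =
      ∑ j, ((x.1 : ℂ)⁻¹) * (W x.1).E (((W x.1).A ^ a) j j * Z x) := by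
    rw [ntr, mul_assoc, WickMatrix.E_algebraMap_mul, Matrix.trace, Finset.sum_mul,
      WickMatrix.E_sum, Finset.mul_sum]
    rfl
  rw [h1, Finset.mul_sum, ← Finset.sum_sub_distrib]
  refine (norm_sum_le_card_part (blk x.1) _ (C := B / x.1 * C) (fun j hj => ?_)
    fun j hj => ?_).trans (le_of_eq (by ring))
  · have e : ((W x.1).v x.2 j : ℂ) * (W x.1).E (((W x.1).A ^ a) j j * Z x) -
        (V (blk x.1 x.2) 1 : ℂ) * ((x.1 : ℂ)⁻¹ * (W x.1).E (((W x.1).A ^ a) j j * Z x)) =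
        (((V (blk x.1 x.2) 0 - V (blk x.1 x.2) 1) / x.1 : ℝ) : ℂ) *
          (W x.1).E (((W x.1).A ^ a) j j * Z x) := by
      rw [hv, hj]; push_cast; ring
    rw [e, norm_mul, Complex.norm_real, Real.norm_eq_abs, abs_div, Nat.abs_cast]
    refine mul_le_mul ?_ (hC x j) (norm_nonneg _) (by positivity)
    gcongr
    exact Finset.single_le_sum (f := fun p => |V p 0 - V p 1|) (fun p _ => abs_nonneg _)
      (Finset.mem_univ _)
  · rw [hv, hj]; push_cast; ring

/-- Joint limits of diagonal entries and normalized traces of powers. -/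
theorem tendsto_E_diag_mul_ntrProd (hW : HasBoundedProfile W K D)
    (hv : ∀ n i j, (W n).v i j = V (blk n i) (blk n j) / n)
    (hm : ∀ n i, (W n).mean i = α (blk n i))
    (hd : Tendsto (fun n : ℕ => ((part (blk n) 0).card : ℝ) / n) atTop (𝓝 0))
    (φ : Fin 2 → ℕ → ℝ) (hφ0 : ∀ p, φ p 0 = 1)
    (hφs : ∀ p k, φ p (k + 1) = α p * φ p k +
      V p 1 * ∑ a ∈ Finset.range k, φ 1 a * φ p (k - 1 - a)) :
    ∀ (b : ℕ) (as : List ℕ), Tendsto (fun x : Σ n : ℕ, Fin n =>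
      (W x.1).E (((W x.1).A ^ b) x.2 x.2 * ntrProd W x.1 as) -
        ((φ (blk x.1 x.2) b * (as.map (φ 1)).prod : ℝ) : ℂ)) indexFilter (𝓝 0)
  | 0, [] => by
    simp [ntrProd, hφ0, WickMatrix.E]
    exact tendsto_const_nhds
  -- No power is left at `i`, so the first trace is opened as an average of `(A^a)_jj` over all `j`;
  -- indices of the first block are negligible, which leaves `φ 1 a`.
  | 0, a :: as => by
    have ih := tendsto_E_diag_mul_ntrProd hW hv hm hd φ hφ0 hφs a as
    have h1 := (tendsto_average ih fun n => Finset.univ).comp tendsto_fst_indexFilter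
    have h2 : Tendsto (fun x : Σ n : ℕ, Fin n => ∑ j, ((x.1 : ℂ)⁻¹ *
        ((φ (blk x.1 j) a - φ 1 a) * (as.map (φ 1)).prod : ℝ))) indexFilter (𝓝 0) := by
      refine squeeze_zero_norm (fun x => ?_) (tendsto_card_part_indexFilter hd
        |(φ 0 a - φ 1 a) * (as.map (φ 1)).prod|)
      refine (norm_sum_le_card_part (blk x.1) _
        (C := (x.1 : ℝ)⁻¹ * |(φ 0 a - φ 1 a) * (as.map (φ 1)).prod|) (fun j hj => ?_)
        fun j hj => ?_).trans (le_of_eq (by ring))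
      · rw [hj, norm_mul, norm_inv, Complex.norm_natCast, Complex.norm_real, Real.norm_eq_abs]
      · simp [hj]
    have h12 := h1.add h2
    rw [add_zero] at h12
    refine h12.congr fun x => ?_
    have hn : (x.1 : ℂ) ≠ 0 := by exact_mod_cast x.2.pos.ne'
    simp only [Function.comp_apply, Finset.card_univ, Fintype.card_fin, pow_zero,
      Matrix.one_apply_eq, one_mul, hφ0, List.map_cons, List.prod_cons, ntrProd]
    rw [← Finset.mul_sum, ← mul_add, ← Finset.sum_add_distrib, ntr, mul_assoc,
      WickMatrix.E_algebraMap_mul, Matrix.trace, Finset.sum_mul, WickMatrix.E_sum]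
    have e : ∀ j : Fin x.1,
        (W x.1).E (((W x.1).A ^ a) j j * (as.map (ntr W x.1)).prod) -
          ((φ (blk x.1 j) a * (as.map (φ 1)).prod : ℝ) : ℂ) +
          (((φ (blk x.1 j) a - φ 1 a) * (as.map (φ 1)).prod : ℝ) : ℂ) =
        (W x.1).E (((W x.1).A ^ a) j j * (as.map (ntr W x.1)).prod) -
          ((φ 1 a * (as.map (φ 1)).prod : ℝ) : ℂ) := fun j => by
      push_cast; ring
    simp only [e, Finset.sum_sub_distrib, Finset.sum_const, Finset.card_univ, Fintype.card_fin,
      nsmul_eq_mul, mul_sub, Matrix.diag_apply]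
    rw [inv_mul_cancel_left₀ hn]
  | k + 1, as => by
    have hQ := momentBounded_ntrProd hW as
    have ih0 := tendsto_E_diag_mul_ntrProd hW hv hm hd φ hφ0 hφs k as
    have iha : ∀ a ∈ Finset.range k, Tendsto (fun x : Σ n : ℕ, Fin n =>
        (W x.1).E (((W x.1).A ^ (k - 1 - a)) x.2 x.2 * ntrProd W x.1 (a :: as)) -
          ((φ (blk x.1 x.2) (k - 1 - a) * ((a :: as).map (φ 1)).prod : ℝ) : ℂ))
        indexFilter (𝓝 0) := fun a ha => by
      have hak := Finset.mem_range.1 ha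
      exact tendsto_E_diag_mul_ntrProd hW hv hm hd φ hφ0 hφs (k - 1 - a) (a :: as)
    have hbd : ∀ f : Fin 2 → ℝ, ∀ x : Σ n : ℕ, Fin n, ‖(f (blk x.1 x.2) : ℂ)‖ ≤ ∑ p, |f p| :=
      fun f x => by
        rw [Complex.norm_real]
        exact Finset.single_le_sum (f := fun p => |f p|) (fun p _ => abs_nonneg _)
          (Finset.mem_univ _)
    have t1 := tendsto_zero_of_bounded_mul (hbd α) ih0
    have t2 := tendsto_finsetSum (Finset.range k) fun a ha =>
      tendsto_zero_of_bounded_mul (hbd fun p => V p 1) (iha a ha)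
    -- The errors `t3`, `t4`, `t5` come from the variance profile, from the `w`-terms and from the
    -- derivative of the traces; `t1` and `t2` are the inductive limits.
    have t3 := tendsto_finsetSum (Finset.range k) fun a (_ : a ∈ Finset.range k) =>
      tendsto_sum_diag hW hv hd ((momentBounded_diag hW (k - 1 - a)).mul hQ) a
    have t4 := tendsto_finsetSum (Finset.range k) fun a (_ : a ∈ Finset.range k) =>
      tendsto_sum_offdiag hW hQ a (k - 1 - a) (fun x j => ((W x.1).w x.2 j : ℂ))
        (fun x j => hW.abs_w_le x.1 x.2 j)
        (fun x j => ((W x.1).A ^ a) j x.2 * ((W x.1).A ^ (k - 1 - a)) j x.2 * ntrProd W x.1 as)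
        (fun x j ω => by rw [map_mul, map_mul, norm_mul, norm_mul])
    have t5 := tendsto_sum_der_ntrProd hW k as MomentBounded.one
    have t := (((t1.add t2).add t3).add t4).add t5
    simp only [Finset.sum_const_zero, add_zero] at t
    refine t.congr fun x => ?_
    have hcomm : ∀ a, ((W x.1).A ^ (k - 1 - a)) x.2 x.2 * ntrProd W x.1 (a :: as) =
        ntr W x.1 a * (((W x.1).A ^ (k - 1 - a)) x.2 x.2 * ntrProd W x.1 as) := fun a => by
      simp only [ntrProd, List.map_cons, List.prod_cons]; ring
    rw [WickMatrix.E_pow_succ_mul, hm, hφs]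
    simp only [hcomm, mul_one, List.map_cons, List.prod_cons, Finset.sum_add_distrib,
      Finset.sum_sub_distrib, mul_sub, Complex.ofReal_add, Complex.ofReal_mul, Complex.ofReal_sum,
      add_mul, Finset.mul_sum, Finset.sum_mul]
    have e : ∑ a ∈ Finset.range k, (V (blk x.1 x.2) 1 : ℂ) *
        ((φ (blk x.1 x.2) (k - 1 - a) : ℂ) * (φ 1 a * ((as.map (φ 1)).prod : ℝ))) =
        ∑ a ∈ Finset.range k, (V (blk x.1 x.2) 1 : ℂ) *
          (φ 1 a * (φ (blk x.1 x.2) (k - 1 - a) : ℂ)) * ((as.map (φ 1)).prod : ℝ) :=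
      Finset.sum_congr rfl fun a _ => by ring
    rw [e]
    ring
-- A Schwinger–Dyson step lowers the total degree; opening a trace keeps the degree but shortens the
-- list.
termination_by b as => (b + as.sum, as.length)
decreasing_by
  all_goals simp_wf
  · exact Prod.Lex.right _ (by simp)
  · exact Prod.Lex.left _ _ (by omega)
  · exact Prod.Lex.left _ _ (by omega)

end BlockLimit

/-! ### The limit theorem. -/

theorem meixnerMatrix_eq {Ω : Type*} {n : ℕ} (blk : Fin n → Fin 2) (α₁ α₂ : ℝ)
    (Y : Ω → Matrix (Fin n) (Fin n) ℂ) (ω : Ω) :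
    meixnerMatrix blk α₁ α₂ Y ω =
      Y ω + Matrix.diagonal fun i => ((if blk i = 0 then α₁ else α₂ : ℝ) : ℂ) := by
  rw [meixnerMatrix, add_assoc]
  congr 1
  ext i j
  by_cases h : i = j
  · subst h
    have : blk i = 0 ∨ blk i = 1 := by omega
    rcases this with h | h <;> simp [blockId, h]
  · simp [blockId, h]

theorem theorem4p1 {Ω : ℕ → Type*} [∀ n, MeasurableSpace (Ω n)]
    (P : (n : ℕ) → Measure (Ω n)) [∀ n, IsProbabilityMeasure (P n)]
    (blk : (n : ℕ) → Fin n → Fin 2)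
    (hne : ∀ᶠ n in atTop, (part (blk n) 0).Nonempty)
    (hd₁ : Tendsto (fun n : ℕ => ((part (blk n) 0).card : ℝ) / n) atTop (𝓝 0))
    (hd₂ : Tendsto (fun n : ℕ => ((part (blk n) 1).card : ℝ) / n) atTop (𝓝 1))
    (V : Matrix (Fin 2) (Fin 2) ℝ) (hV : V.IsSymm)
    (Y : (n : ℕ) → Ω n → Matrix (Fin n) (Fin n) ℂ)
    (hY : ∀ n, IsBlockGaussian (P n) (blk n) V (Y n))
    (α₁ α₂ β₁ β₂ : ℝ) (hβ₁ : β₁ = V 1 0) (hβ₂ : β₂ = V 1 1)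
    (hβ₁_pos : 0 < β₁) (hβ₂_pos : 0 < β₂) :
    (∀ m : ℕ,
      (∀ n, Integrable
        (fun ω => partialTrace (blk n) 0 (meixnerMatrix (blk n) α₁ α₂ (Y n) ω ^ m)) (P n)) ∧
      Tendsto
        (fun n => expPartialTrace (P n) (blk n) 0
          fun ω => meixnerMatrix (blk n) α₁ α₂ (Y n) ω ^ m)
        atTop (𝓝 (state₁ ((gaussOp β₁ β₂ + gammaOp α₁ α₂ β₁ β₂) ^ m)))) ∧
    ∃ μ : Measure ℝ, IsFreeMeixnerLaw α₁ α₂ β₁ β₂ μ ∧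
      (∀ ν : Measure ℝ, IsFreeMeixnerLaw α₁ α₂ β₁ β₂ ν → ν = μ) ∧
      ∀ m : ℕ, state₁ ((gaussOp β₁ β₂ + gammaOp α₁ α₂ β₁ β₂) ^ m) = ((∫ x, x ^ m ∂μ : ℝ) : ℂ) := by
  choose W hmean hv hmat using fun n =>
    exists_wickMatrix (hY n) fun i => if blk n i = 0 then α₁ else α₂
  have hWb : HasBoundedProfile W (∑ p, ∑ q, |V p q|) (|α₁| + |α₂|) := by
    refine ⟨by positivity, fun n i j => ?_, fun n i => ?_⟩
    · rw [hv]
      refine div_le_div_of_nonneg_right ?_ (Nat.cast_nonneg n)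
      calc V (blk n i) (blk n j) ≤ |V (blk n i) (blk n j)| := le_abs_self _
        _ ≤ ∑ q, |V (blk n i) q| := Finset.single_le_sum (f := fun q => |V (blk n i) q|)
            (fun q _ => abs_nonneg _) (Finset.mem_univ _)
        _ ≤ _ := Finset.single_le_sum (f := fun p => ∑ q, |V p q|)
            (fun p _ => Finset.sum_nonneg fun q _ => abs_nonneg _) (Finset.mem_univ _)
    · rw [hmean]
      have := abs_nonneg α₁
      have := abs_nonneg α₂
      dsimp only
      split_ifs <;> linarith
  have htrace : ∀ m n, ∀ᵐ ω ∂(P n),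
      partialTrace (blk n) 0 (meixnerMatrix (blk n) α₁ α₂ (Y n) ω ^ m) =
        ((part (blk n) 0).card : ℂ)⁻¹ *
          ∑ i ∈ part (blk n) 0, (W n).ev ω (((W n).A ^ m) i i) := fun m n => by
    filter_upwards [hmat n] with ω hω
    rw [meixnerMatrix_eq, ← hω, partialTrace]
    simp only [WickMatrix.ev_pow_apply]
  have hint : ∀ m n, Integrable (fun ω => ((part (blk n) 0).card : ℂ)⁻¹ *
      ∑ i ∈ part (blk n) 0, (W n).ev ω (((W n).A ^ m) i i)) (P n) := fun m n =>
    (integrable_finsetSum _ fun i _ => (W n).integrable _).const_mul _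
  refine ⟨fun m => ⟨fun n => (hint m n).congr ((htrace m n).mono fun ω hω => hω.symm), ?_⟩,
    exists_isFreeMeixnerLaw hβ₁_pos hβ₂_pos⟩
  let φ : Fin 2 → ℕ → ℝ := fun p =>
    if p = 0 then meixnerMoment α₁ α₂ β₁ β₂ else semicircleMoment α₂ β₂
  have hφ0 : ∀ p, φ p 0 = 1 := fun p => by
    simp only [φ]; split_ifs
    · exact meixnerMoment_zero _ _ _ _
    · exact semicircleMoment_zero _ _
  have hφs : ∀ p k, φ p (k + 1) = (if p = 0 then α₁ else α₂) * φ p k +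
      V p 1 * ∑ a ∈ Finset.range k, φ 1 a * φ p (k - 1 - a) := fun p k => by
    -- The recursion for the first block involves the entry `V 0 1`; symmetry of `V` identifies it
    -- with `β₁`.
    have h01 : V 0 1 = β₁ := by rw [hβ₁, hV.apply]
    fin_cases p
    · simpa [φ, h01] using meixnerMoment_succ α₁ α₂ β₁ β₂ k
    · simpa [φ, ← hβ₂] using semicircleMoment_succ α₂ β₂ k
  -- The joint limit with no traces, averaged over the first block, where the limit of every term is
  -- `φ 0 m`.
  have hlim := tendsto_average (tendsto_E_diag_mul_ntrProd (α := fun p => if p = 0 then α₁ else α₂)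
    hWb hv (fun n i => by rw [hmean]) hd₁ φ hφ0 hφs m []) fun n => part (blk n) 0
  have hstate : state₁ ((gaussOp β₁ β₂ + gammaOp α₁ α₂ β₁ β₂) ^ m) = (φ 0 m : ℂ) :=
    state₁_jacobiOp_pow hβ₁_pos hβ₂_pos m
  rw [hstate]
  have hlim' := hlim.add_const (φ 0 m : ℂ)
  rw [zero_add] at hlim'
  refine hlim'.congr' ?_
  filter_upwards [hne] with n hn
  have hcard : ((part (blk n) 0).card : ℂ) ≠ 0 := by exact_mod_cast hn.card_pos.ne'
  have hexp : expPartialTrace (P n) (blk n) 0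
      (fun ω => meixnerMatrix (blk n) α₁ α₂ (Y n) ω ^ m) =
      ((part (blk n) 0).card : ℂ)⁻¹ * ∑ i ∈ part (blk n) 0, (W n).E (((W n).A ^ m) i i) := by
    rw [expPartialTrace, integral_congr_ae (htrace m n), integral_const_mul,
      integral_finsetSum _ fun i _ => (W n).integrable _]
    rfl
  have hconst : ∑ i ∈ part (blk n) 0, ((φ (blk n i) m : ℝ) : ℂ) =
      (part (blk n) 0).card * (φ 0 m : ℂ) := by
    rw [Finset.sum_congr rfl fun i hi => by rw [(Finset.mem_filter.1 hi).2], Finset.sum_const,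
      nsmul_eq_mul]
  simp only [ntrProd, List.map_nil, List.prod_nil, mul_one, Finset.sum_sub_distrib]
  rw [hexp, hconst, mul_sub, inv_mul_cancel_left₀ hcard, sub_add_cancel]
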